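/- Let $p$ be a prime, let $n,m\ge 1$ be integers, and let $K/F$ be a Galois extension of fields with $\mathrm{Gal}(K/F)=\langle\sigma\rangle\simeq\mathbb{Z}/p^n\mathbb{Z}$, where $F$ contains a primitive $p$-th root of unity $\xi_p$. For $0\le i\le n$ let $K_i$ be the intermediate field of degree $p^i$ over $F$, and put $K_{-\infty}^\times=\{1\}$. Let $\omega\in\mathbb{N}\cup\{\infty\}$ (respectively $\nu$) be the largest $k$ such that $F$ (respectively $K$) contains the group $\mu_{p^k}$ of $p^k$-th roots of unity, with value $\infty$ if this happens for all $k$. For $\mathbf a=(a_0,\dots,a_{m-1})\in\{-\infty,0,1,\dots,n\}^m$ with $a_0<n$ and $d\in 1+p\mathbb{Z}$, call $(\mathbf a,d)$ a norm pair of length $m$ if there are $\alpha,\delta_m\in K^\times$ and $\delta_i\in K_{a_i}^\times$ for $0\le i<m$ with $$\alpha^\sigma=\alpha^d\,\delta_0\delta_1^p\cdots\delta_m^{p^m},\qquad \xi_p=N_{K/F}(\alpha)^{\frac{d-1}{p}}\cdot N_{K_{n-1}/F}(\delta_0)\cdot\prod_{i=1}^m N_{K/F}(\delta_i)^{p^{i-1}}.$$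 Order the norm pairs of length $m$ by $(\mathbf a,d)\le(\mathbf a',d')$ if either $\mathbf a<\mathbf a'$ lexicographically, or $\mathbf a=\mathbf a'$ and $\min\{v_p(d'-1),m\}\le\min\{v_p(d-1),m\}$ (where $v_p$ is the $p$-adic valuation, $v_p(0)=\infty$). A norm pair $(\mathbf a,d)$ is minimal if every norm pair $(\mathbf a',d')\le(\mathbf a,d)$ also satisfies $(\mathbf a,d)\le(\mathbf a',d')$. Theorem. If $p=2$ and $n=1$, suppose that $-1\in N_{K/F}(K^\times)$. If $p=2$, suppose that we are not in the case $\omega=1<\nu$. Let $(\mathbf a,d)$ be a minimal norm pair of length $m$. (1) If $\omega<\nu$, then for every integer $\tilde d\equiv d\pmod{p^\nu}$ the pair $(\mathbf a,\tilde d)$ is a minimal norm pair of length $m$ (if $\nu=\infty$, the congruence means $\tilde d=d$). (2) If $\omega=\nu$, then $d\equiv 1\pmod{p^m}$. (3) $d$ is congruent modulo $p^{\min\{m,\nu\}}$ to the value at $\sigma$ of the cyclotomic character of $K/F$; that is, $\sigma(\zeta)=\zeta^d$ for all $\zeta\in\mu_{p^{\min\{m,\nu\}}}$. -/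

import Mathlib

section PrimePowerRoots

/-- The largest `k` (possibly `⊤`) such that the field `L` contains a primitive
`p ^ k`-th root of unity. For `L = F` this is `ω`, and for `L = K` it is `ν`. -/
noncomputable def rootLevel (p : ℕ) (L : Type*) [Field L] : ℕ∞ :=
  ⨆ (k : ℕ) (_ : ∃ ζ : L, IsPrimitiveRoot ζ (p ^ k)), (k : ℕ∞)

/-- Below the level `rootLevel p L` the field `L` contains all `p`-power roots of unity. -/
theorem exists_isPrimitiveRoot_of_le_rootLevel {p : ℕ} [hp : Fact p.Prime] {L : Type*} [Field L]
    {k : ℕ} (hk : (k : ℕ∞) ≤ rootLevel p L) : ∃ ζ : L, IsPrimitiveRoot ζ (p ^ k) := by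
  rcases Nat.eq_zero_or_pos k with rfl | hpos
  · exact ⟨1, by simp⟩
  have hlt : ((k - 1 : ℕ) : ℕ∞) < rootLevel p L :=
    lt_of_lt_of_le (by exact_mod_cast Nat.sub_lt hpos one_pos) hk
  obtain ⟨j, hj⟩ := lt_iSup_iff.1 hlt
  obtain ⟨⟨ζ, hζ⟩, hj'⟩ := lt_iSup_iff.1 hj
  have hkj : k ≤ j := by
    have : k - 1 < j := by exact_mod_cast hj'
    omega
  exact ⟨ζ ^ p ^ (j - k), hζ.pow (pow_pos hp.out.pos _)
    (by rw [← pow_add, Nat.sub_add_cancel hkj])⟩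

theorem natCard_rootsOfUnity_of_le_rootLevel {p : ℕ} [hp : Fact p.Prime] {L : Type*} [Field L]
    {k : ℕ} (hk : (k : ℕ∞) ≤ rootLevel p L) :
    Nat.card { x // x ∈ rootsOfUnity (p ^ k) L } = p ^ k := by
  have : NeZero (p ^ k) := ⟨pow_ne_zero _ hp.out.ne_zero⟩
  obtain ⟨ζ, hζ⟩ := exists_isPrimitiveRoot_of_le_rootLevel hk
  exact hζ.card_rootsOfUnity

/-- The value at `σ ∈ Gal(K/F)` of the cyclotomic character of `K/F` modulo `p ^ k`, where `K`
contains the `p ^ k`-th roots of unity: the class `c` with `σ ζ = ζ ^ c` for all `ζ ∈ μ_{p^k}`. -/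
noncomputable def cyclotomicCharacterMod {p : ℕ} [hp : Fact p.Prime] {F K : Type*} [Field F]
    [Field K] [Algebra F K] {k : ℕ} (hk : (k : ℕ∞) ≤ rootLevel p K) (σ : Gal(K/F)) :
    ZMod (p ^ k) :=
  haveI : NeZero (p ^ k) := ⟨pow_ne_zero _ hp.out.ne_zero⟩
  ((modularCyclotomicCharacter K (natCard_rootsOfUnity_of_le_rootLevel hk) σ.toRingEquiv :
    (ZMod (p ^ k))ˣ) : ZMod (p ^ k))

/-- Congruence of integers modulo `p ^ e`, where `e` may be infinite
(congruence modulo `p ^ ⊤` is congruence modulo every power of `p`, that is, equality). -/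
def CongrModPow (p : ℕ) (e : ℕ∞) (x y : ℤ) : Prop :=
  ∀ k : ℕ, (k : ℕ∞) ≤ e → x ≡ y [ZMOD (p : ℤ) ^ k]

end PrimePowerRoots

section NormPairs

variable {F K : Type*} [Field F] [Field K] [Algebra F K]

/-- For a generator `σ` of the cyclic group `Gal(K/F)` of order `p ^ n`, the intermediate
field `K_i` of degree `p ^ i` over `F`: the fixed field of `σ ^ (p ^ i)`. -/
def cyclicLayer (p : ℕ) (σ : Gal(K/F)) (i : ℕ) : IntermediateField F K :=
  IntermediateField.fixedField (Subgroup.zpowers (σ ^ p ^ i))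

/-- The multiplicative group of `K_j`, for `j ∈ {-∞, 0, …, n}`; here `⊥` stands for `-∞`
and the group for `-∞` is trivial. -/
def layerUnits (p : ℕ) (σ : Gal(K/F)) {n : ℕ} : WithBot (Fin (n + 1)) → Set Kˣ
  | ⊥ => {1}
  | (j : Fin (n + 1)) => {u | (u : K) ∈ cyclicLayer p σ j}

/-- `(α, δ_0, …, δ_m)` represents the pair `(a, d)`. The element `ε` is `δ_0`, viewed in
`K_{n-1}` so that its norm from `K_{n-1}` to `F` can be taken. -/
def Represents (p n m : ℕ) (σ : Gal(K/F)) (ξ : F) (a : Fin m → WithBot (Fin (n + 1))) (d : ℤ)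
    (α : Kˣ) (δ : Fin (m + 1) → Kˣ) : Prop :=
  (∀ i : Fin m, δ i.castSucc ∈ layerUnits p σ (a i)) ∧
  σ (α : K) = (α : K) ^ d * ∏ i : Fin (m + 1), (δ i : K) ^ p ^ (i : ℕ) ∧
  ∃ ε : cyclicLayer p σ (n - 1), (ε : K) = (δ 0 : K) ∧
    ξ = Algebra.norm F (α : K) ^ ((d - 1) / (p : ℤ)) * Algebra.norm F ε *
      ∏ i : Fin m, Algebra.norm F (δ i.succ : K) ^ p ^ (i : ℕ)

/-- `(a, d)` is a norm pair of length `m`: `a_0 < n`, `d ∈ 1 + pℤ` and `(a, d)` is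
represented by some elements of `Kˣ`. -/
def IsNormPair (p n m : ℕ) (σ : Gal(K/F)) (ξ : F) (a : Fin m → WithBot (Fin (n + 1)))
    (d : ℤ) : Prop :=
  (∀ i : Fin m, (i : ℕ) = 0 → a i < (Fin.last n : WithBot (Fin (n + 1)))) ∧
  d ≡ 1 [ZMOD p] ∧
  ∃ (α : Kˣ) (δ : Fin (m + 1) → Kˣ), Represents p n m σ ξ a d α δ

/-- The ordering of pairs: lexicographic in `a`, and for equal `a` the pair with the larger
value of `min {v_p(d - 1), m}` is the smaller one. -/
def NormPairLE (p : ℕ) {n m : ℕ} (a : Fin m → WithBot (Fin (n + 1))) (d : ℤ)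
    (a' : Fin m → WithBot (Fin (n + 1))) (d' : ℤ) : Prop :=
  toLex a < toLex a' ∨
    (a = a' ∧ min (emultiplicity (p : ℤ) (d' - 1)) (m : ℕ∞) ≤
      min (emultiplicity (p : ℤ) (d - 1)) (m : ℕ∞))

/-- `(a, d)` is a minimal element, for `NormPairLE`, of the norm pairs of length `m`. -/
def IsMinimalNormPair (p n m : ℕ) (σ : Gal(K/F)) (ξ : F) (a : Fin m → WithBot (Fin (n + 1)))
    (d : ℤ) : Prop :=
  IsNormPair p n m σ ξ a d ∧
  ∀ (a' : Fin m → WithBot (Fin (n + 1))) (d' : ℤ), IsNormPair p n m σ ξ a' d' →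
    NormPairLE p a' d' a d → NormPairLE p a d a' d'

end NormPairs

/-! Write `Kˣ` additively as a `ℤ[X]`-module with `X` acting as `σ`. A norm pair is then an equation
`(X - d)α = Σ p^i δ_i` together with an equation for `ξ`. Multiplying by `(X^{p^n} - d^{p^n}) / (X -
d)` turns the left side into `(1 - d^{p^n})α`, while on `K_a` an integer divisible by `p^{n-a}`
splits off from this polynomial. So if `h + a_i ≤ n + i` for all `i` and `p^h ∣ p^n (d - 1)`
(`DivBound`), both sides can be divided by `p^h`. The difference `η` of the quotients satisfies `(X
- d)η = 0`, and the norm equation gives `p^{h-1}η = -ξ` (`Rep.root_of_divided`). Thus `η` is a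
primitive `p^h`-th root of unity on which `σ` acts through `d`.

Minimality yields `DivBound` up to `min(m, ν)`, one power at a time (`Rep.divBound_succ_or_lower`).
If `K` has a root of order one power higher, `η` is a `p`-th power, and `d` can be adjusted to act
correctly on a `p`-th root of it. If the bound is tight at some levels, dividing once more shows
that a product of norms of the tight `δ_i` is a `p`-th power in `F`. Hilbert 90 then moves the tight
`δ_i` of least index into a smaller layer, up to terms `(X - 1)y` and `p`-th powers that higher
levels absorb. This contradicts minimality.

Part (3) follows, and for `k ≤ min(m, ν)` also `p^k ∣ d - 1` if and only if `k ≤ ω`. For (1) and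
(2), `d` is changed modulo `p^ν` when `ν < m`: either a large layer absorbs the change
(`Rep.exists_of_modEq`), or `p^{ν+1} ∤ p^n (d - 1)` and a root of unity alone represents the new
pair (`Rep.exists_of_not_divisible`). When `m ≤ ν`, the free element `δ_m` absorbs the change. -/

namespace CyclicNormPair

open Polynomial Finset

/-! ### Geometric polynomials and their twisted analogues. -/

/-- The polynomial `1 + X + ⋯ + X ^ (k - 1)`. -/
noncomputable def geomPoly (k : ℕ) : ℤ[X] := ∑ t ∈ range k, X ^ t

/-- The polynomial `(X ^ k - d ^ k) / (X - d)`. -/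
noncomputable def twGeomPoly (d : ℤ) (k : ℕ) : ℤ[X] :=
  ∑ t ∈ range k, X ^ t * (d : ℤ[X]) ^ (k - 1 - t)

theorem geomPoly_mul_sub_one (k : ℕ) : geomPoly k * (X - 1) = X ^ k - 1 :=
  geom_sum_mul X k

theorem twGeomPoly_mul_sub (d : ℤ) (k : ℕ) :
    twGeomPoly d k * (X - (d : ℤ[X])) = X ^ k - (d : ℤ[X]) ^ k :=
  (Commute.all _ _).geom_sum₂_mul k

theorem X_sub_intCast_ne_zero (d : ℤ) : (X - (d : ℤ[X])) ≠ 0 := X_sub_C_ne_zero d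

theorem geomPoly_mul (k l : ℕ) :
    geomPoly (k * l) = geomPoly k * ∑ j ∈ range l, ((X : ℤ[X]) ^ k) ^ j := by
  have h : (X - 1 : ℤ[X]) ≠ 0 := by simpa using X_sub_intCast_ne_zero 1
  apply mul_right_cancel₀ h
  rw [geomPoly_mul_sub_one, mul_right_comm, geomPoly_mul_sub_one, pow_mul, mul_comm, geom_sum_mul]

theorem twGeomPoly_mul (d : ℤ) (k l : ℕ) :
    twGeomPoly d (k * l) = twGeomPoly d k *
      ∑ j ∈ range l, ((X : ℤ[X]) ^ k) ^ j * ((d : ℤ[X]) ^ k) ^ (l - 1 - j) := by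
  apply mul_right_cancel₀ (X_sub_intCast_ne_zero d)
  rw [twGeomPoly_mul_sub, mul_right_comm, twGeomPoly_mul_sub, pow_mul, pow_mul, mul_comm,
    (Commute.all _ _).geom_sum₂_mul]

theorem sum_range_mul_pow {R : Type*} [CommRing R] (y : R) (k l : ℕ) :
    ∑ j ∈ range (k * l), y ^ j = (∑ j ∈ range k, y ^ j) * ∑ j ∈ range l, (y ^ k) ^ j := by
  induction l with
  | zero => simp
  | succ l ih =>
    rw [Nat.mul_succ, sum_range_add, ih, sum_range_succ, mul_add, sum_mul _ _ ((y ^ k) ^ l)]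
    congr 1
    exact sum_congr rfl fun j _ => by rw [pow_add, pow_mul, mul_comm]

/-! ### Exact powers of `p` in integer geometric sums. -/

/-- `d ≡ 1 mod p`, and `d ≡ 1 mod 4` when `p = 2`. -/
def Regular (p : ℕ) (d : ℤ) : Prop := (p : ℤ) ∣ d - 1 ∧ (p = 2 → (4 : ℤ) ∣ d - 1)

theorem dvd_pow_sub_one {c d : ℤ} (h : c ∣ d - 1) (k : ℕ) : c ∣ d ^ k - 1 :=
  h.trans (sub_one_dvd_pow_sub_one d k)

theorem Regular.pow {p : ℕ} {d : ℤ} (h : Regular p d) (k : ℕ) : Regular p (d ^ k) :=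
  ⟨dvd_pow_sub_one h.1 k, fun h2 => dvd_pow_sub_one (h.2 h2) k⟩

theorem dvd_sum_pow_sub {c y : ℤ} (h : c ∣ y - 1) (k : ℕ) : c ∣ (∑ j ∈ range k, y ^ j) - k := by
  have : (∑ j ∈ range k, y ^ j) - k = ∑ j ∈ range k, (y ^ j - 1) := by simp
  rw [this]
  exact dvd_sum fun j _ => dvd_pow_sub_one h j

theorem pow_dvd_sum_pow {p : ℕ} {y : ℤ} (h : (p : ℤ) ∣ y - 1) (k : ℕ) :
    (p : ℤ) ^ k ∣ ∑ j ∈ range (p ^ k), y ^ j := by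
  induction k with
  | zero => simp
  | succ k ih =>
    rw [pow_succ, pow_succ, sum_range_mul_pow]
    refine mul_dvd_mul ih ?_
    have := dvd_sum_pow_sub (dvd_pow_sub_one h (p ^ k)) p
    exact (dvd_sub_self_right).1 this

/-- With `y = 1 + pc` one has `y^j ≡ 1 + pcj` modulo `p²`, so the sum is `p + pc · p(p-1)/2` modulo
`p²`, and the second term vanishes for odd `p`. For `p = 2` the sum is `1 + y`, which is why `y ≡ 1`
modulo 4 is needed. -/
theorem Regular.sum_pow_eq_one_add {p : ℕ} [hp : Fact p.Prime] {y : ℤ} (h : Regular p y) :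
    ∃ w : ℤ, ∑ j ∈ range p, y ^ j = p * (1 + p * w) := by
  obtain ⟨c, hc⟩ := h.1
  obtain rfl : y = 1 + p * c := by linarith
  rcases hp.out.eq_two_or_odd' with rfl | hodd
  · obtain ⟨b, hb⟩ := h.2 rfl
    refine ⟨b, ?_⟩
    simp [sum_range_succ]
    push_cast at hb
    linarith
  · have key : ∀ k : ℕ, (p : ℤ) ^ 2 ∣ (∑ j ∈ range k, (1 + (p : ℤ) * c) ^ j)
        - (k + p * c * ((∑ j ∈ range k, j : ℕ) : ℤ)) := by
      intro k
      have : (∑ j ∈ range k, (1 + (p : ℤ) * c) ^ j) - (k + p * c * ((∑ j ∈ range k, j : ℕ) : ℤ))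
          = ∑ j ∈ range k, ((1 + (p : ℤ) * c) ^ j - (1 + p * c * j)) := by
        rw [sum_sub_distrib, sum_add_distrib, ← mul_sum]
        simp
      rw [this]
      refine dvd_sum fun j hj => ?_
      clear hj
      induction j with
      | zero => simp
      | succ j ih =>
        obtain ⟨b, hb⟩ := ih
        refine ⟨b * (1 + p * c) + c ^ 2 * j, ?_⟩
        have : (1 + (p : ℤ) * c) ^ j = 1 + p * c * j + p ^ 2 * b := by linarith
        rw [pow_succ, this]
        push_cast
        ring
    obtain ⟨b, hb⟩ := key p
    obtain ⟨r, hr⟩ := hodd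
    have hs : (∑ j ∈ range p, j : ℕ) = p * r := by
      rw [sum_range_id, hr]
      have : (2 * r + 1) * (2 * r + 1 - 1) = (2 * r + 1) * r * 2 := by
        rw [Nat.add_sub_cancel]; ring
      rw [this, Nat.mul_div_cancel _ two_pos]
    rw [hs] at hb
    push_cast at hb
    exact ⟨b + c * r, by linarith⟩

theorem Regular.sum_pow_eq {p : ℕ} [hp : Fact p.Prime] {y : ℤ} (h : Regular p y) (k : ℕ) :
    ∃ w : ℤ, ∑ j ∈ range (p ^ k), y ^ j = p ^ k * (1 + p * w) := by
  induction k with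
  | zero => exact ⟨0, by simp⟩
  | succ k ih =>
    obtain ⟨w, hw⟩ := ih
    obtain ⟨v, hv⟩ := (h.pow (p ^ k)).sum_pow_eq_one_add
    exact ⟨w + v + p * w * v, by rw [pow_succ, sum_range_mul_pow, hw, hv]; ring⟩

/-! ### Congruences modulo `p` and modulo `X ^ k - 1`. -/

/-- Divisibility by a monic polynomial is insensitive to integer multiples. -/
theorem dvd_of_dvd_intCast_mul {f g : ℤ[X]} (hf : f.Monic) {k : ℤ} (hk : k ≠ 0)
    (h : f ∣ (k : ℤ[X]) * g) : f ∣ g := by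
  rw [← modByMonic_eq_zero_iff_dvd hf] at h ⊢
  have : (k : ℤ[X]) * g = k • g := by simp
  rw [this, smul_modByMonic] at h
  exact (smul_eq_zero.1 h).resolve_left hk

theorem exists_twGeomPoly_eq {p : ℕ} {d : ℤ} (h : (p : ℤ) ∣ d - 1) (k : ℕ) :
    ∃ W : ℤ[X], twGeomPoly d k = geomPoly k + (p : ℤ[X]) * W := by
  have : (p : ℤ[X]) ∣ twGeomPoly d k - geomPoly k := by
    rw [twGeomPoly, geomPoly, ← sum_sub_distrib]
    refine dvd_sum fun t _ => ?_
    obtain ⟨c, hc⟩ := dvd_pow_sub_one h (k - 1 - t)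
    refine ⟨X ^ t * (c : ℤ[X]), ?_⟩
    have : (d : ℤ[X]) ^ (k - 1 - t) - 1 = p * c := by exact_mod_cast congrArg (Int.cast : ℤ → ℤ[X]) hc
    linear_combination X ^ t * this
  obtain ⟨W, hW⟩ := this
  exact ⟨W, by linear_combination hW⟩

theorem X_pow_sub_one_dvd_sum (k l : ℕ) (c : ℕ → ℤ[X]) :
    (X ^ k - 1 : ℤ[X]) ∣ ∑ j ∈ range l, (X ^ k) ^ j * c j - ∑ j ∈ range l, c j := by
  rw [← sum_sub_distrib]
  refine dvd_sum fun j _ => ?_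
  have : ((X : ℤ[X]) ^ k) ^ j * c j - c j = ((X ^ k) ^ j - 1) * c j := by ring
  rw [this]
  exact (sub_one_dvd_pow_sub_one _ j).mul_right _

theorem X_pow_sub_one_dvd_geomPoly (k l : ℕ) :
    (X ^ k - 1 : ℤ[X]) ∣ geomPoly (k * l) - (l : ℤ[X]) * geomPoly k := by
  rw [geomPoly_mul]
  have := X_pow_sub_one_dvd_sum k l fun _ => 1
  simp only [mul_one, sum_const, card_range, nsmul_eq_mul] at this
  convert this.mul_left (geomPoly k) using 1
  ring

/-- Modulo `X ^ k - 1` the cofactor in `twGeomPoly_mul` collapses to an integer. For `l = p ^ (n -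
a)` this integer is the source of the divisibility used throughout. -/
theorem X_pow_sub_one_dvd_twGeomPoly (d : ℤ) (k l : ℕ) :
    (X ^ k - 1 : ℤ[X]) ∣ twGeomPoly d (k * l)
      - ((∑ j ∈ range l, (d ^ k) ^ j : ℤ) : ℤ[X]) * twGeomPoly d k := by
  rw [twGeomPoly_mul]
  have := (X_pow_sub_one_dvd_sum k l fun j => ((d : ℤ[X]) ^ k) ^ (l - 1 - j)).mul_left
    (twGeomPoly d k)
  rw [sum_range_reflect (fun j => ((d : ℤ[X]) ^ k) ^ j) l] at this
  convert this using 1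
  push_cast
  ring

/-! ### Representations of norm pairs in an abstract module. -/

section Module

variable {M : Type*} [AddCommGroup M] [Module ℤ[X] M]

/-- The properties of the multiplicative group of a cyclic extension of degree `p ^ n`, as a
module on which `X` acts as a generator of the Galois group, that are used below. Here `ξ` stands
for a primitive `p`-th root of unity in the base field. -/
structure CyclicData (p n : ℕ) (ξ : M) : Prop where
  period : ∀ x : M, (X : ℤ[X]) ^ p ^ n • x = x
  hilbert90 : ∀ b < n, ∀ x : M, (∑ j ∈ range (p ^ (n - b)), ((X : ℤ[X]) ^ p ^ b) ^ j) • x = 0 →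
    ∃ w : M, x = (X ^ p ^ b - 1 : ℤ[X]) • w
  torsion : ∀ x : M, (p : ℤ[X]) • x = 0 → ∃ j : ℤ, x = (j : ℤ[X]) • ξ
  prime_smul : (p : ℤ[X]) • ξ = 0
  fixed : (X : ℤ[X]) • ξ = ξ
  ne_zero : ξ ≠ 0

/-- The elements fixed by `X ^ p ^ a`; for `⊥` only zero. -/
def InLayer (p : ℕ) : WithBot ℕ → M → Prop
  | ⊥, x => x = 0
  | (a : ℕ), x => (X : ℤ[X]) ^ p ^ a • x = x

/-- The coefficient of the `i`-th element in the norm equation. -/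
noncomputable def normCoeff (p n i : ℕ) : ℤ[X] :=
  if i = 0 then geomPoly (p ^ (n - 1)) else (p : ℤ[X]) ^ (i - 1) * geomPoly (p ^ n)

/-- Additive form of a representation of a norm pair with `d = 1 + p * e`. -/
structure Rep (p n m : ℕ) (ξ : M) (L : ℕ → WithBot ℕ) (d e : ℤ) (α : M) (δ : ℕ → M) : Prop where
  eq_one_add : d = 1 + p * e
  layer : ∀ i ≤ m, InLayer p (L i) (δ i)
  sub_smul : (X - (d : ℤ[X])) • α = ∑ i ∈ range (m + 1), (p : ℤ[X]) ^ i • δ i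
  norm_eq : ξ = ((e : ℤ[X]) * geomPoly (p ^ n)) • α + ∑ i ∈ range (m + 1), normCoeff p n i • δ i

theorem smul_eq_smul_of_dvd {f g g' : ℤ[X]} {x : M} (hx : f • x = 0) (h : f ∣ g - g') :
    g • x = g' • x := by
  obtain ⟨c, hc⟩ := h
  have : g = g' + c * f := by linear_combination hc
  rw [this, add_smul, mul_smul, hx, smul_zero, add_zero]

theorem X_pow_sub_one_smul {k : ℕ} {x : M} (hx : (X : ℤ[X]) ^ k • x = x) :
    (X ^ k - 1 : ℤ[X]) • x = 0 := by rw [sub_smul, hx, one_smul, sub_self]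

theorem twGeomPoly_smul {p n a : ℕ} (ha : a ≤ n) (d : ℤ) {x : M}
    (hx : (X : ℤ[X]) ^ p ^ a • x = x) : twGeomPoly d (p ^ n) • x =
      (((∑ j ∈ range (p ^ (n - a)), (d ^ p ^ a) ^ j : ℤ) : ℤ[X]) * twGeomPoly d (p ^ a)) • x := by
  refine smul_eq_smul_of_dvd (X_pow_sub_one_smul hx) ?_
  have := X_pow_sub_one_dvd_twGeomPoly d (p ^ a) (p ^ (n - a))
  rwa [← pow_add, Nat.add_sub_cancel' ha] at this

theorem geomPoly_smul {p n a : ℕ} (ha : a ≤ n) {x : M}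
    (hx : (X : ℤ[X]) ^ p ^ a • x = x) : geomPoly (p ^ n) • x =
      ((p : ℤ[X]) ^ (n - a) * geomPoly (p ^ a)) • x := by
  refine smul_eq_smul_of_dvd (X_pow_sub_one_smul hx) ?_
  have := X_pow_sub_one_dvd_geomPoly (p ^ a) (p ^ (n - a))
  rw [← pow_add, Nat.add_sub_cancel' ha] at this
  exact_mod_cast this

theorem X_pow_smul_of_le {p n a : ℕ} (ha : a ≤ n) {x : M}
    (hx : (X : ℤ[X]) ^ p ^ a • x = x) : (X : ℤ[X]) ^ p ^ n • x = x := by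
  have h : (X ^ p ^ a - 1 : ℤ[X]) ∣ X ^ p ^ n - 1 := by
    conv_rhs => rw [← Nat.add_sub_cancel' ha, pow_add, pow_mul]
    exact sub_one_dvd_pow_sub_one _ _
  simpa using smul_eq_smul_of_dvd (X_pow_sub_one_smul hx) h

/-! ### Dividing the contribution of a single `δ_i` by `p ^ h`. -/

section Divided

variable {p n a i h : ℕ} {c d κ : ℤ} {W : ℤ[X]} {x : M}

/-- Since `M` has `p`-torsion, quotients by `p ^ h` are not unique. The element `κ * twGeomPoly d (p
^ a) • x` is an explicit choice, whose behaviour under `X - d` and smaller powers of `p` can be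
computed in `ℤ[X]`. -/
theorem pow_smul_divided (ha : a ≤ n) (hx : (X : ℤ[X]) ^ p ^ a • x = x)
    (hκ : (p : ℤ) ^ i * ∑ j ∈ range (p ^ (n - a)), (d ^ p ^ a) ^ j = p ^ h * κ) :
    (p : ℤ[X]) ^ h • ((κ : ℤ[X]) * twGeomPoly d (p ^ a)) • x =
      ((p : ℤ[X]) ^ i * twGeomPoly d (p ^ n)) • x := by
  have hκ' := congrArg (Int.cast : ℤ → ℤ[X]) hκ
  have h1 := twGeomPoly_smul ha d hx
  push_cast at hκ' h1
  rw [mul_smul _ (twGeomPoly d (p ^ n)), h1, ← mul_smul, ← mul_smul]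
  congr 1
  linear_combination (-twGeomPoly d (p ^ a)) * hκ'

theorem mul_one_sub_pow (hp : p ≠ 0) (ha : a ≤ n) (hc : (p : ℤ) ^ h * c = 1 - d ^ p ^ n)
    (hκ : (p : ℤ) ^ i * ∑ j ∈ range (p ^ (n - a)), (d ^ p ^ a) ^ j = p ^ h * κ) :
    κ * (1 - d ^ p ^ a) = c * p ^ i := by
  apply mul_left_cancel₀ (pow_ne_zero h (Nat.cast_ne_zero.2 hp : (p : ℤ) ≠ 0))
  have h3 := geom_sum_mul (d ^ p ^ a) (p ^ (n - a))
  rw [← pow_mul, ← pow_add, Nat.add_sub_cancel' ha] at h3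
  linear_combination (-(1 - d ^ p ^ a)) * hκ - (p : ℤ) ^ i * h3 - p ^ i * hc

theorem sub_smul_divided (hp : p ≠ 0) (ha : a ≤ n) (hx : (X : ℤ[X]) ^ p ^ a • x = x)
    (hc : (p : ℤ) ^ h * c = 1 - d ^ p ^ n)
    (hκ : (p : ℤ) ^ i * ∑ j ∈ range (p ^ (n - a)), (d ^ p ^ a) ^ j = p ^ h * κ) :
    (X - (d : ℤ[X])) • ((κ : ℤ[X]) * twGeomPoly d (p ^ a)) • x =
      ((c : ℤ[X]) * (p : ℤ[X]) ^ i) • x := by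
  have h1 := mul_one_sub_pow hp ha hc hκ
  have h1' := congrArg (Int.cast : ℤ → ℤ[X]) h1
  push_cast at h1'
  have h2 := twGeomPoly_mul_sub d (p ^ a)
  have h3 : (X - (d : ℤ[X])) * ((κ : ℤ[X]) * twGeomPoly d (p ^ a)) =
      (κ : ℤ[X]) * (X ^ p ^ a - 1) + (c : ℤ[X]) * (p : ℤ[X]) ^ i := by
    linear_combination (κ : ℤ[X]) * h2 + h1'
  rw [← mul_smul, h3, add_smul, mul_smul, X_pow_sub_one_smul hx, smul_zero, zero_add]

/-- The norm coefficients come from saving one factor `p`. For `i > 0` it is taken from `p ^ i`; for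
`i = 0` it is the degree of `K` over `K_{n-1}`, available because `a < n`. -/
theorem pow_pred_smul_divided (hp : p ≠ 0) (hh : 1 ≤ h)
    (hW : twGeomPoly d (p ^ n) = geomPoly (p ^ n) + (p : ℤ[X]) * W)
    (ha : a ≤ n) (hi : i = 0 → a < n) (hx : (X : ℤ[X]) ^ p ^ a • x = x)
    (hκ : (p : ℤ) ^ i * ∑ j ∈ range (p ^ (n - a)), (d ^ p ^ a) ^ j = p ^ h * κ) :
    (p : ℤ[X]) ^ (h - 1) • ((κ : ℤ[X]) * twGeomPoly d (p ^ a)) • x =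
      normCoeff p n i • x + ((p : ℤ[X]) ^ i * W) • x := by
  have hp' : (p : ℤ) ≠ 0 := by exact_mod_cast hp
  obtain ⟨h, rfl⟩ := Nat.exists_eq_add_of_le' hh
  rw [Nat.add_sub_cancel, normCoeff]
  split_ifs with h0
  · subst h0
    rw [← mul_smul, ← add_smul]
    refine smul_eq_smul_of_dvd (X_pow_sub_one_smul hx) ?_
    -- Cancelling `p` is illegitimate in `M`, but allowed in `ℤ[X]` modulo the monic `X ^ p ^ a -
    -- 1`.
    refine dvd_of_dvd_intCast_mul (monic_X_pow_sub_C 1 (pow_ne_zero a hp)) hp' ?_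
    have hκ' := congrArg (Int.cast : ℤ → ℤ[X]) hκ
    obtain ⟨u, hu⟩ := X_pow_sub_one_dvd_twGeomPoly d (p ^ a) (p ^ (n - a))
    obtain ⟨v, hv⟩ := X_pow_sub_one_dvd_geomPoly (p ^ a) (p ^ (n - a))
    obtain ⟨w, hw⟩ := X_pow_sub_one_dvd_geomPoly (p ^ a) (p ^ (n - 1 - a))
    have han := hi rfl
    rw [← pow_add, Nat.add_sub_cancel' ha] at hu hv
    rw [← pow_add, Nat.add_sub_cancel' (by omega)] at hw
    have e1 : n - a = n - 1 - a + 1 := by omega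
    have hv' : geomPoly (p ^ n) - (p : ℤ[X]) * (p : ℤ[X]) ^ (n - 1 - a) * geomPoly (p ^ a) =
        (X ^ p ^ a - 1) * v := by
      rw [← hv, e1]; push_cast; ring
    refine ⟨v - u - p * w, ?_⟩
    push_cast at hκ' hu hw ⊢
    linear_combination (-twGeomPoly d (p ^ a)) * hκ' + hW - hu + hv' - (p : ℤ[X]) * hw
  · obtain ⟨i, rfl⟩ := Nat.exists_eq_succ_of_ne_zero h0
    have h1 : (p : ℤ) ^ i * ∑ j ∈ range (p ^ (n - a)), (d ^ p ^ a) ^ j = p ^ h * κ := by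
      apply mul_left_cancel₀ hp'
      rw [pow_succ, pow_succ] at hκ
      linear_combination hκ
    rw [pow_smul_divided ha hx h1, hW, ← add_smul]
    congr 1
    rw [Nat.succ_eq_add_one, Nat.add_sub_cancel]
    ring

end Divided

/-- The term `e * geomPoly k` is the coefficient of `α` in the norm equation. Hence the discrepancy
`W` between twisted and plain geometric polynomials is what links the two equations of a
representation. -/
theorem mul_sub_eq_of_twGeomPoly_eq {p k : ℕ} {d e b : ℤ} {W : ℤ[X]} (hp : p ≠ 0)
    (hd : d = 1 + p * e) (hW : twGeomPoly d k = geomPoly k + (p : ℤ[X]) * W)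
    (hb : (p : ℤ) * b = 1 - d ^ k) : W * (X - (d : ℤ[X])) = (b : ℤ[X]) + (e : ℤ[X]) * geomPoly k := by
  have hp' : (p : ℤ[X]) ≠ 0 := by exact_mod_cast hp
  apply mul_left_cancel₀ hp'
  have h1 := twGeomPoly_mul_sub d k
  have h2 := geomPoly_mul_sub_one k
  have h3 := congrArg (Int.cast : ℤ → ℤ[X]) hb
  have h4 := congrArg (Int.cast : ℤ → ℤ[X]) hd
  push_cast at h3 h4
  linear_combination h1 - h2 - h3 - (X - (d : ℤ[X])) * hW + geomPoly k * h4

/-- The root of unity attached to a representation whose equation can be divided by `p ^ h`. -/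
theorem Rep.root_of_divided {p n m : ℕ} {ξ : M} {L : ℕ → WithBot ℕ} {d e : ℤ} {α : M} {δ : ℕ → M}
    (R : Rep p n m ξ L d e α δ) (hp : p ≠ 0) {h : ℕ} {c : ℤ} {W : ℤ[X]}
    (hc : (p : ℤ) ^ (h + 1) * c = 1 - d ^ p ^ n)
    (hW : twGeomPoly d (p ^ n) = geomPoly (p ^ n) + (p : ℤ[X]) * W) {y : ℕ → M}
    (hy : ∀ i ≤ m, (X - (d : ℤ[X])) • y i = ((c : ℤ[X]) * (p : ℤ[X]) ^ i) • δ i)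
    (hy' : ∀ i ≤ m, (p : ℤ[X]) ^ h • y i = normCoeff p n i • δ i + ((p : ℤ[X]) ^ i * W) • δ i) :
    (X - (d : ℤ[X])) • ((c : ℤ[X]) • α - ∑ i ∈ range (m + 1), y i) = 0 ∧
      (p : ℤ[X]) ^ h • ((c : ℤ[X]) • α - ∑ i ∈ range (m + 1), y i) = -ξ := by
  constructor
  · rw [smul_sub, smul_sum, smul_comm, R.sub_smul, smul_sum, ← sum_sub_distrib]
    refine sum_eq_zero fun i hi => ?_
    rw [hy i (Nat.lt_succ_iff.1 (mem_range.1 hi)), mul_smul, sub_self]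
  · have h1 : (p : ℤ[X]) ^ h • ∑ i ∈ range (m + 1), y i =
        ∑ i ∈ range (m + 1), normCoeff p n i • δ i +
          W • ∑ i ∈ range (m + 1), (p : ℤ[X]) ^ i • δ i := by
      rw [smul_sum, smul_sum, ← sum_add_distrib]
      refine sum_congr rfl fun i hi => ?_
      rw [hy' i (Nat.lt_succ_iff.1 (mem_range.1 hi)), mul_comm, mul_smul]
    have hb : (p : ℤ) * (p ^ h * c) = 1 - d ^ p ^ n := by rw [← hc]; ring
    have h2 := mul_sub_eq_of_twGeomPoly_eq hp R.eq_one_add hW hb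
    have h3 := R.norm_eq
    rw [← R.sub_smul, ← mul_smul, h2] at h1
    rw [smul_sub, h1]
    push_cast
    linear_combination (norm := module) h3

theorem X_smul_geomPoly_smul {k : ℕ} {x : M} (hx : (X : ℤ[X]) ^ k • x = x) :
    (X : ℤ[X]) • geomPoly k • x = geomPoly k • x := by
  have h := congrArg (· • x) (geomPoly_mul_sub_one k)
  simp only [X_pow_sub_one_smul hx] at h
  linear_combination (norm := module) h

section Terms

variable {p n i h : ℕ} {c d : ℤ} {W : ℤ[X]} {x : M} {l : WithBot ℕ}

/-- Modulo `p` the twisted polynomial `twGeomPoly d (p ^ a)` is the norm of `K_a` over `F`, so the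
quotient is fixed by `X` up to a multiple of `p`. -/
theorem exists_divided [hp : Fact p.Prime] (hd : (p : ℤ) ∣ d - 1)
    (hc : (p : ℤ) ^ (h + 1) * c = 1 - d ^ p ^ n)
    (hW : twGeomPoly d (p ^ n) = geomPoly (p ^ n) + (p : ℤ[X]) * W)
    (hx : InLayer p l x) (hl : ∀ a : ℕ, l = a → a ≤ n ∧ h + 1 + a ≤ n + i ∧ (i = 0 → a < n)) :
    ∃ y : M, (X - (d : ℤ[X])) • y = ((c : ℤ[X]) * (p : ℤ[X]) ^ i) • x ∧
      (p : ℤ[X]) ^ h • y = normCoeff p n i • x + ((p : ℤ[X]) ^ i * W) • x ∧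
      ∃ f z : M, y = f + (p : ℤ[X]) • z ∧ (X : ℤ[X]) • f = f := by
  have hp0 := hp.out.ne_zero
  cases l with
  | bot =>
    obtain rfl : x = 0 := hx
    exact ⟨0, by simp, by simp, 0, 0, by simp, by simp⟩
  | coe a =>
    have hx : (X : ℤ[X]) ^ p ^ a • x = x := hx
    obtain ⟨ha, hha, hi⟩ := hl a rfl
    obtain ⟨ψ, hψ⟩ := pow_dvd_sum_pow (dvd_pow_sub_one hd (p ^ a)) (n - a)
    have hκ : (p : ℤ) ^ i * ∑ j ∈ range (p ^ (n - a)), (d ^ p ^ a) ^ j =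
        p ^ (h + 1) * (p ^ (n + i - a - (h + 1)) * ψ) := by
      rw [hψ, ← mul_assoc, ← mul_assoc, ← pow_add, ← pow_add]
      congr 2
      omega
    refine ⟨_, sub_smul_divided hp0 ha hx hc hκ,
      pow_pred_smul_divided hp0 (Nat.le_add_left 1 h) hW ha hi hx hκ, ?_⟩
    obtain ⟨V, hV⟩ := exists_twGeomPoly_eq hd (p ^ a)
    generalize p ^ (n + i - a - (h + 1)) * ψ = κ
    refine ⟨(κ : ℤ[X]) • geomPoly (p ^ a) • x, (κ : ℤ[X]) • V • x, ?_, ?_⟩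
    · rw [hV]; module
    · rw [smul_comm, X_smul_geomPoly_smul hx]

/-- One more division by `p` is possible unless `h + 1 + a = n + i`. In that tight case regularity
leaves the integer factor `1 + pw`, so the quotient is a prime-to-`p` multiple `g` of a norm, plus
`p • v`. The formula for `(X - d) • v` is again derived in `ℤ[X]`, where `p` can be cancelled. -/
theorem exists_divided_decomposition [hp : Fact p.Prime] {e : ℤ} (hd : d = 1 + p * e)
    (hreg : Regular p d) (hc : (p : ℤ) ^ (h + 2) * c = 1 - d ^ p ^ n)
    (hW : twGeomPoly d (p ^ n) = geomPoly (p ^ n) + (p : ℤ[X]) * W)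
    (hx : InLayer p l x) (hl : ∀ a : ℕ, l = a → a ≤ n ∧ h + 1 + a ≤ n + i ∧ (i = 0 → a < n)) :
    ∃ g v : M, (X - (d : ℤ[X])) • (g + (p : ℤ[X]) • v) =
        (((p * c : ℤ) : ℤ[X]) * (p : ℤ[X]) ^ i) • x ∧
      (p : ℤ[X]) ^ h • (g + (p : ℤ[X]) • v) = normCoeff p n i • x + ((p : ℤ[X]) ^ i * W) • x ∧
      (X : ℤ[X]) • g = g ∧
      (X - (d : ℤ[X])) • v = ((c : ℤ[X]) * (p : ℤ[X]) ^ i) • x + (e : ℤ[X]) • g ∧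
      ∃ w : ℤ, ((∀ a : ℕ, l = a → h + 1 + a ≠ n + i) ∧ g = 0) ∨ 
        ∃ a : ℕ, l = a ∧ h + 1 + a = n + i ∧ 
          g = ((1 + p * w : ℤ) : ℤ[X]) • geomPoly (p ^ a) • x := by
  have hp0 := hp.out.ne_zero
  by_cases hS : ∃ a : ℕ, l = a ∧ h + 1 + a = n + i
  · obtain ⟨a, rfl, hha⟩ := hS
    have hx : (X : ℤ[X]) ^ p ^ a • x = x := hx
    obtain ⟨ha, -, hi⟩ := hl a rfl
    obtain ⟨w, hw⟩ := (hreg.pow (p ^ a)).sum_pow_eq (n - a)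
    have hκ : (p : ℤ) ^ i * ∑ j ∈ range (p ^ (n - a)), (d ^ p ^ a) ^ j =
        p ^ (h + 1) * (1 + p * w) := by
      rw [hw, ← mul_assoc, ← pow_add]
      congr 2
      omega
    have hc' : (p : ℤ) ^ (h + 1) * (p * c) = 1 - d ^ p ^ n := by rw [← hc]; ring
    obtain ⟨V, hV⟩ := exists_twGeomPoly_eq hreg.1 (p ^ a)
    obtain ⟨b, hb⟩ := dvd_sub_comm.1 (dvd_pow_sub_one hreg.1 (p ^ a))
    have hy : ((1 + p * w : ℤ) : ℤ[X]) • geomPoly (p ^ a) • x +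
        (p : ℤ[X]) • (((1 + p * w : ℤ) : ℤ[X]) * V) • x =
        (((1 + p * w : ℤ) : ℤ[X]) * twGeomPoly d (p ^ a)) • x := by rw [hV]; module
    refine ⟨((1 + p * w : ℤ) : ℤ[X]) • geomPoly (p ^ a) • x, (((1 + p * w : ℤ) : ℤ[X]) * V) • x,
      ?_, ?_, ?_, ?_, w, Or.inr ⟨a, rfl, hha, rfl⟩⟩
    · rw [hy]; exact sub_smul_divided hp0 ha hx hc' hκ
    · rw [hy]; exact pow_pred_smul_divided hp0 (Nat.le_add_left 1 h) hW ha hi hx hκ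
    · rw [smul_comm, X_smul_geomPoly_smul hx]
    · have h1 := mul_sub_eq_of_twGeomPoly_eq hp0 hd hV hb.symm
      have h2 := mul_one_sub_pow hp0 ha hc' hκ
      have h3 : (1 + p * w) * b = c * p ^ i := by
        apply mul_left_cancel₀ (Nat.cast_ne_zero.2 hp0 : (p : ℤ) ≠ 0)
        rw [hb] at h2
        linear_combination h2
      have h4 := congrArg (Int.cast : ℤ → ℤ[X]) h3
      have h5 : (X - (d : ℤ[X])) * (((1 + p * w : ℤ) : ℤ[X]) * V) = (c : ℤ[X]) * (p : ℤ[X]) ^ i +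
          (e : ℤ[X]) * (((1 + p * w : ℤ) : ℤ[X]) * geomPoly (p ^ a)) := by
        push_cast at h4 ⊢
        linear_combination (1 + (p : ℤ[X]) * w) * h1 + h4
      rw [← mul_smul, h5]
      module
  · push Not at hS
    obtain ⟨y, hy, hy', -⟩ := exists_divided (h := h + 1) hreg.1 hc hW hx fun a ha => by
      obtain ⟨h1, h2, h3⟩ := hl a ha
      have := hS a ha
      exact ⟨h1, by omega, h3⟩
    refine ⟨0, y, ?_, ?_, smul_zero _, ?_, 0, Or.inl ⟨hS, rfl⟩⟩
    · rw [zero_add, smul_comm, hy]; push_cast; module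
    · rw [zero_add, ← hy']; module
    · rw [hy]; module

end Terms

/-! ### Torsion and relative norms. -/

theorem CyclicData.exists_smul_of_pow_smul_eq_zero {p n : ℕ} {ξ : M} (H : CyclicData p n ξ)
    {k : ℕ} {ζ : M} (hζ : (p : ℤ[X]) ^ k • ζ = ξ) {η : M} (hη : (p : ℤ[X]) ^ (k + 1) • η = 0) :
    ∃ j : ℤ, η = (j : ℤ[X]) • ζ := by
  induction k generalizing η ζ with
  | zero =>
    obtain rfl : ζ = ξ := by simpa using hζ
    exact H.torsion η (by simpa using hη)
  | succ k ih =>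
    obtain ⟨j, hj⟩ := ih (ζ := (p : ℤ[X]) • ζ) (η := (p : ℤ[X]) • η)
      (by rw [← hζ]; module) (by rw [← hη]; module)
    obtain ⟨i, hi⟩ := H.torsion (η - (j : ℤ[X]) • ζ)
      (by linear_combination (norm := module) hj)
    refine ⟨j + i * p ^ (k + 1), ?_⟩
    push_cast
    linear_combination (norm := module) hi - (i : ℤ[X]) • hζ

theorem CyclicData.pow_dvd_of_smul_eq_zero {p n : ℕ} [hp : Fact p.Prime] {ξ : M}
    (H : CyclicData p n ξ) {k : ℕ} {ζ : M} (hζ : (p : ℤ[X]) ^ k • ζ = ξ) {j : ℤ}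
    (hj : (j : ℤ[X]) • ζ = 0) : (p : ℤ) ^ (k + 1) ∣ j := by
  have h1 : ∀ j : ℤ, (j : ℤ[X]) • ζ = j • ζ := fun j => Int.cast_smul_eq_zsmul _ _ _
  have h2 : addOrderOf ζ = p ^ (k + 1) := by
    refine addOrderOf_eq_prime_pow (fun h => H.ne_zero ?_) ?_
    · rw [← natCast_zsmul, ← h1] at h
      rw [← hζ, ← h]; simp
    · rw [← natCast_zsmul, ← h1, ← H.prime_smul, ← hζ, ← mul_smul]
      push_cast
      rw [pow_succ']
  have h3 := addOrderOf_dvd_iff_zsmul_eq_zero.2 ((h1 j).symm.trans hj)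
  rw [h2] at h3
  exact_mod_cast h3

/-- The norm annihilates `X - 1`, so only `P` modulo `X - 1` matters. -/
theorem CyclicData.geomPoly_smul_mul {p n : ℕ} {ξ : M} (H : CyclicData p n ξ) (P : ℤ[X]) (x : M) :
    (geomPoly (p ^ n) * P) • x = ((P.eval 1 : ℤ) : ℤ[X]) • geomPoly (p ^ n) • x := by
  obtain ⟨Q, hQ⟩ := X_sub_C_dvd_sub_C_eval (a := (1 : ℤ)) (p := P)
  have h1 : P = ((P.eval 1 : ℤ) : ℤ[X]) + (X - 1) * Q := by
    simp only [map_one, eq_intCast] at hQ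
    linear_combination hQ
  have h2 : geomPoly (p ^ n) * P =
      ((P.eval 1 : ℤ) : ℤ[X]) * geomPoly (p ^ n) + Q * (X ^ p ^ n - 1) := by
    rw [← geomPoly_mul_sub_one]
    linear_combination geomPoly (p ^ n) * h1
  rw [h2, add_smul, mul_smul, mul_smul, X_pow_sub_one_smul (H.period x), smul_zero, add_zero]

theorem layer_sum_smul {p a b : ℕ} (ha : a ≤ b) {x : M} (hx : (X : ℤ[X]) ^ p ^ b • x = x) :
    (X : ℤ[X]) ^ p ^ a • (∑ j ∈ range (p ^ (b - a)), ((X : ℤ[X]) ^ p ^ a) ^ j) • x =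
      (∑ j ∈ range (p ^ (b - a)), ((X : ℤ[X]) ^ p ^ a) ^ j) • x := by
  have h1 := geom_sum_mul ((X : ℤ[X]) ^ p ^ a) (p ^ (b - a))
  rw [← pow_mul, ← pow_add, Nat.add_sub_cancel' ha] at h1
  have h2 := congrArg (· • x) h1
  simp only [X_pow_sub_one_smul hx] at h2
  linear_combination (norm := module) h2

theorem geomPoly_mul_sum {p a b : ℕ} (ha : a ≤ b) : geomPoly (p ^ a) *
    ∑ j ∈ range (p ^ (b - a)), ((X : ℤ[X]) ^ p ^ a) ^ j = geomPoly (p ^ b) := by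
  rw [← geomPoly_mul, ← pow_add, Nat.add_sub_cancel' ha]

theorem CyclicData.normCoeff_smul_sum {p n : ℕ} {ξ : M} (H : CyclicData p n ξ) {i a : ℕ}
    (ha : a ≤ n) (hia : i = 0 → a < n) (x : M) :
    normCoeff p n i • (∑ j ∈ range (p ^ (n - a)), ((X : ℤ[X]) ^ p ^ a) ^ j) • x =
      ((p : ℤ[X]) ^ (i + (n - a) - 1) * geomPoly (p ^ n)) • x := by
  rw [normCoeff]
  split_ifs with h0
  · have han := hia h0
    rw [geomPoly_smul (by omega : a ≤ n - 1) (layer_sum_smul ha (H.period x)), ← mul_smul,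
      mul_assoc, geomPoly_mul_sum ha]
    congr 3; omega
  · rw [← mul_smul, mul_assoc, mul_smul, H.geomPoly_smul_mul, ← mul_smul, ← mul_smul]
    congr 1
    have : i + (n - a) - 1 = i - 1 + (n - a) := by omega
    rw [this, pow_add, eval_finsetSum]
    simp

/-! ### Changing `d` by absorption into a large layer. -/

/-- The congruence class of `d` can be changed modulo `p ^ s` at the cost of a level that is
large enough: the absorption of `p ^ s • x`. -/
theorem CyclicData.exists_absorb {p n : ℕ} [hp : Fact p.Prime] {ξ : M} (H : CyclicData p n ξ)
    {m i a : ℕ} (hm : 1 ≤ m) (ha : a ≤ n) (hia : i = 0 → a < n) {d e : ℤ}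
    (hd : d = 1 + p * e) (k : ℕ) : ∀ s : ℕ, n + i ≤ s + a → 1 ≤ s → m ≤ s + k →
      (m ≤ s ∨ Regular p d) → ∀ x : M, ∃ g y r : M, (X : ℤ[X]) ^ p ^ a • g = g ∧
        (p : ℤ[X]) ^ s • x = (p : ℤ[X]) ^ i • g + (X - (d : ℤ[X])) • y + (p : ℤ[X]) ^ m • r ∧
        ((p : ℤ[X]) ^ (s - 1) * geomPoly (p ^ n)) • x = normCoeff p n i • g -
          ((e : ℤ[X]) * geomPoly (p ^ n)) • y + ((p : ℤ[X]) ^ (m - 1) * geomPoly (p ^ n)) • r := by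
  -- `k` bounds `m - s`: each step raises `s` by one, until `p ^ s` can be absorbed by `p ^ m • r`.
  induction k with
  | zero =>
    intro s _ hs hms _ x
    refine ⟨0, 0, (p : ℤ[X]) ^ (s - m) • x, by simp, ?_, ?_⟩
    · rw [smul_zero, smul_zero, zero_add, zero_add, ← mul_smul, ← pow_add]
      congr 2; omega
    · rw [smul_zero, smul_zero, sub_zero, zero_add, ← mul_smul, mul_right_comm, ← pow_add]
      congr 3; omega
  | succ k ih =>
    intro s hs hs1 hmk hreg x
    by_cases hms : m ≤ s
    · refine ⟨0, 0, (p : ℤ[X]) ^ (s - m) • x, by simp, ?_, ?_⟩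
      · rw [smul_zero, smul_zero, zero_add, zero_add, ← mul_smul, ← pow_add]
        congr 2; omega
      · rw [smul_zero, smul_zero, sub_zero, zero_add, ← mul_smul, mul_right_comm, ← pow_add]
        congr 3; omega
    · replace hreg := hreg.resolve_left hms
      obtain ⟨w, hw⟩ := (hreg.pow (p ^ a)).sum_pow_eq (n - a)
      -- The norm `S` to layer `a` is `p ^ (n - a) * (1 + p * w)` modulo `X - d`. Replacing `p ^ (n
      -- - a) • x` by `S • x` therefore leaves the error `-w • x` with one more factor `p`, which is
      -- treated by induction.
      obtain ⟨g, y, r, hg, h1, h2⟩ := ih (s + 1) (by omega) (by omega) (by omega) (Or.inr hreg)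
        (((-w : ℤ) : ℤ[X]) • x)
      -- division of the norm by `X - d`
      obtain ⟨Y, hY⟩ : (X - (d : ℤ[X])) ∣ (∑ j ∈ range (p ^ (n - a)), ((X : ℤ[X]) ^ p ^ a) ^ j) -
          (((p : ℤ) ^ (n - a) * (1 + p * w) : ℤ) : ℤ[X]) := by
        rw [← hw]
        push_cast
        rw [← sum_sub_distrib]
        refine dvd_sum fun j _ => ?_
        rw [← pow_mul, ← pow_mul]
        exact sub_dvd_pow_sub_pow _ _ _
      have hsi : s - 1 + 1 = s := by omega
      have hst : i + (n - a) + (s + a - n - i) = s := by omega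
      have hst' : i + (n - a) - 1 + (s + a - n - i) = s - 1 ∨ i + (n - a) = 0 := by omega
      have hst'' := hst'.resolve_right (by omega)
      set t := s + a - n - i
      set S : ℤ[X] := ∑ j ∈ range (p ^ (n - a)), ((X : ℤ[X]) ^ p ^ a) ^ j
      have hp0 : (p : ℤ) ≠ 0 := Nat.cast_ne_zero.2 hp.out.ne_zero
      -- Polynomials act on norms through their value at 1, so this is what the norm equation
      -- retains of `Y`.
      have hY1 : e * Y.eval 1 = p ^ (n - a) * w := by
        have h3 := congrArg (eval 1) hY
        simp only [S, eval_sub, eval_mul, eval_X, eval_intCast, eval_finsetSum, eval_pow,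
          one_pow, sum_const, card_range, nsmul_eq_mul, mul_one] at h3
        push_cast at h3
        apply mul_left_cancel₀ hp0
        rw [hd] at h3
        linear_combination h3
      have hY2 := congrArg (Int.cast : ℤ → ℤ[X]) hY1
      push_cast at hY2 hY h1 h2
      refine ⟨g + (p : ℤ[X]) ^ t • S • x, y - ((p : ℤ[X]) ^ (t + i) * Y) • x, r, ?_, ?_, ?_⟩
      · rw [smul_add, hg, smul_comm, layer_sum_smul ha (H.period x)]
      · have h3 : (p : ℤ[X]) ^ s = (p : ℤ[X]) ^ (t + i) * (p : ℤ[X]) ^ (n - a) := by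
          rw [← pow_add]; congr 1; omega
        have h4 := congrArg (fun P => ((p : ℤ[X]) ^ (t + i) * P) • x) hY
        rw [pow_succ, h3] at h1
        rw [h3]
        rw [pow_add] at h1 h4 ⊢
        linear_combination (norm := module) h1 - h4
      · have h3 : (p : ℤ[X]) ^ s = (p : ℤ[X]) ^ (t + i) * (p : ℤ[X]) ^ (n - a) := by
          rw [← pow_add]; congr 1; omega
        have h4 := H.normCoeff_smul_sum (i := i) ha hia x
        have h5 := H.geomPoly_smul_mul Y x
        have h6 := congrArg (fun P => ((p : ℤ[X]) ^ (t + i) * P) • geomPoly (p ^ n) • x) hY2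
        rw [h3] at h2
        rw [← hst'', pow_add]
        linear_combination (norm := module) h2 - (p : ℤ[X]) ^ t • h4 -
          ((e : ℤ[X]) * (p : ℤ[X]) ^ (t + i)) • h5 - h6

/-- Admissible levels for representations of length `m`. -/
structure Admissible (n m : ℕ) (L : ℕ → WithBot ℕ) : Prop where
  le : ∀ i ≤ m, L i ≤ (n : WithBot ℕ)
  zero_lt : L 0 < (n : WithBot ℕ)
  top : L m = (n : WithBot ℕ)

theorem Admissible.le_of_eq {n m : ℕ} {L : ℕ → WithBot ℕ} (hL : Admissible n m L) {i a : ℕ}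
    (hi : i ≤ m) (ha : L i = a) : a ≤ n ∧ (i = 0 → a < n) := by
  refine ⟨by exact_mod_cast ha ▸ hL.le i hi, ?_⟩
  rintro rfl
  exact_mod_cast ha ▸ hL.zero_lt

theorem InLayer.add {p : ℕ} {l : WithBot ℕ} {x y : M} (hx : InLayer p l x) (hy : InLayer p l y) :
    InLayer p l (x + y) := by
  cases l with
  | bot => exact (congrArg₂ (· + ·) hx hy).trans (add_zero 0)
  | coe a => exact (smul_add _ _ _).trans (congrArg₂ (· + ·) hx hy)

theorem InLayer.smul {p : ℕ} {l : WithBot ℕ} {x : M} (hx : InLayer p l x) (f : ℤ[X]) :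
    InLayer p l (f • x) := by
  cases l with
  | bot => exact (congrArg (f • ·) hx).trans (smul_zero f)
  | coe a => exact (smul_comm _ _ _).trans (congrArg (f • ·) hx)

theorem InLayer.zero {p : ℕ} (l : WithBot ℕ) : InLayer p l (0 : M) := by
  cases l with
  | bot => rfl
  | coe a => exact smul_zero _

/-- The class of `d` modulo `p ^ s` suffices when some level is large enough. -/
theorem Rep.exists_of_modEq {p n : ℕ} [hp : Fact p.Prime] {ξ : M} (H : CyclicData p n ξ)
    {m : ℕ} (hm : 1 ≤ m) {L : ℕ → WithBot ℕ} (hL : Admissible n m L) {d e : ℤ} {α : M} {δ : ℕ → M}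
    (R : Rep p n m ξ L d e α δ) {i a s : ℕ} (hi : i ≤ m) (ha : L i = a) (hs : n + i ≤ s + a)
    {d' e' : ℤ} (hd' : d' = 1 + p * e') (hdd : (p : ℤ) ^ s ∣ d' - d)
    (hreg : m ≤ s ∨ Regular p d') : ∃ α' δ', Rep p n m ξ L d' e' α' δ' := by
  obtain ⟨han, hia⟩ := hL.le_of_eq hi ha
  have hs1 : 1 ≤ s := by
    rcases Nat.eq_zero_or_pos i with h | h
    · have := hia h; omega
    · omega
  obtain ⟨t, ht⟩ := hdd
  have hp0 : (p : ℤ) ≠ 0 := Nat.cast_ne_zero.2 hp.out.ne_zero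
  obtain ⟨s, rfl⟩ := Nat.exists_eq_add_of_le' hs1
  have het : e' - e = p ^ s * t := by
    apply mul_left_cancel₀ hp0
    rw [hd', R.eq_one_add, pow_succ] at ht
    linear_combination ht
  have ht' := congrArg (Int.cast : ℤ → ℤ[X]) ht
  have het' := congrArg (Int.cast : ℤ → ℤ[X]) het
  -- Replacing `d` by `d'` in the equation for `α` creates the error `p ^ (s + 1) • (-t • α)`, to be
  -- absorbed by `δ i`, `δ m` and `α`.
  obtain ⟨g, y, r, hg, h1, h2⟩ := H.exists_absorb hm han hia hd' m (s + 1) hs hs1 (by omega) hreg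
    (((-t : ℤ) : ℤ[X]) • α)
  push_cast at h1 h2 ht' het'
  have hgi : ∀ f : ℕ → ℤ[X], ∑ j ∈ range (m + 1), f j • (if j = i then g else 0) = f i • g := by
    intro f
    rw [sum_eq_single i (fun j _ hj => by simp [hj]) fun h => (h (by simp; omega)).elim]
    simp
  have hrm : ∀ f : ℕ → ℤ[X], ∑ j ∈ range (m + 1), f j • (if j = m then r else 0) = f m • r := by
    intro f
    rw [sum_eq_single m (fun j _ hj => by simp [hj]) fun h => (h (by simp)).elim]
    simp
  refine ⟨α - y, fun j => δ j + (if j = i then g else 0) + (if j = m then r else 0), hd', ?_, ?_,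
    ?_⟩
  · intro j hj
    refine ((R.layer j hj).add ?_).add ?_
    · split_ifs with h
      · subst h; rw [ha]; exact hg
      · exact InLayer.zero _
    · split_ifs with h
      · subst h; rw [hL.top]; exact H.period r
      · exact InLayer.zero _
  · simp only [smul_add, sum_add_distrib]
    rw [hgi, hrm, ← R.sub_smul]
    have h3 := congrArg (· • α) ht'
    linear_combination (norm := module) h1 - h3
  · simp only [smul_add, sum_add_distrib]
    have hnm : normCoeff p n m = (p : ℤ[X]) ^ (m - 1) * geomPoly (p ^ n) := by
      rw [normCoeff, if_neg (by omega)]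
    have h3 := congrArg (· • geomPoly (p ^ n) • α) het'
    have h4 := R.norm_eq
    rw [hgi, hrm, hnm]
    linear_combination (norm := module) h4 - h3 + h2

/-! ### Lowering a level with Hilbert 90. -/

theorem sum_smul_ite_eq {m i : ℕ} (hi : i ≤ m) (f : ℕ → ℤ[X]) (g : M) :
    ∑ j ∈ range (m + 1), f j • (if j = i then g else 0) = f i • g := by
  rw [sum_eq_single i (fun j _ hj => by simp [hj]) fun h => (h (by simp; omega)).elim]
  simp

/-- Lowering the level `i`, at the cost of the higher levels. -/
theorem Rep.exists_lower {p n : ℕ} {ξ : M} (H : CyclicData p n ξ) {m : ℕ} {L : ℕ → WithBot ℕ}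
    {d e : ℤ} {α : M} {δ : ℕ → M} (R : Rep p n m ξ L d e α δ) {i : ℕ} (hi : i < m) {w : ℤ}
    {x y r : M} (h : ((1 + p * w : ℤ) : ℤ[X]) • δ i = x + (X - 1 : ℤ[X]) • y + (p : ℤ[X]) • r)
    (h0 : i = 0 → geomPoly (p ^ (n - 1)) • ((1 + p * w : ℤ) : ℤ[X]) • δ i =
      geomPoly (p ^ (n - 1)) • x + geomPoly (p ^ n) • r) {l : WithBot ℕ} (hx : InLayer p l x) :
    ∃ α' δ', Rep p n m ξ (fun j => if j < i then L j else if j = i then l else n) d e α' δ' := by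
  set u : ℤ[X] := ((1 + p * w : ℤ) : ℤ[X]) with hu
  have hnorm : normCoeff p n i • (x - u • δ i) = -(((p : ℤ[X]) ^ i * geomPoly (p ^ n)) • r) := by
    rw [normCoeff]
    split_ifs with hi0
    · rw [smul_sub, h0 hi0, hi0]
      module
    · obtain ⟨i, rfl⟩ := Nat.exists_eq_succ_of_ne_zero hi0
      have h1 : geomPoly (p ^ n) • (X - 1 : ℤ[X]) • y = 0 := by
        rw [← mul_smul, geomPoly_mul_sub_one, X_pow_sub_one_smul (H.period y)]
      rw [h, Nat.succ_eq_add_one, Nat.add_sub_cancel, pow_succ]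
      linear_combination (norm := module) (-(p : ℤ[X]) ^ i) • h1
  -- Multiplication by `u` preserves `ξ`, as `u ≡ 1` modulo `p`. Because `X - 1 = (X - d) + p * e`,
  -- the part `(X - 1) • y` of `u • δ i` moves partly into `α` and partly, as `e • y`, into `δ (i +
  -- 1)`.
  refine ⟨u • α - (p : ℤ[X]) ^ i • y, fun j => u • δ j + (if j = i then x - u • δ i else 0) +
    (if j = i + 1 then r + (e : ℤ[X]) • y else 0), R.eq_one_add, ?_, ?_, ?_⟩
  · intro j hj
    rcases lt_trichotomy j i with h1 | rfl | h1
    · rw [if_pos h1, if_neg h1.ne, if_neg (by omega), add_zero, add_zero]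
      exact (R.layer j hj).smul u
    · rw [if_neg (lt_irrefl j), if_pos rfl, if_pos rfl, if_neg (by omega), add_zero,
        add_sub_cancel]
      exact hx
    · rw [if_neg h1.not_gt, if_neg h1.ne']
      exact H.period _
  · simp only [smul_add, sum_add_distrib, sum_smul_ite_eq hi.le, sum_smul_ite_eq hi]
    have h1 : ∑ j ∈ range (m + 1), (p : ℤ[X]) ^ j • u • δ j = u • (X - (d : ℤ[X])) • α := by
      rw [R.sub_smul, smul_sum]
      exact sum_congr rfl fun j _ => smul_comm _ _ _
    have hd := congrArg (fun k : ℤ => (k : ℤ[X]) • (p : ℤ[X]) ^ i • y) R.eq_one_add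
    push_cast at hd
    rw [h1, h, pow_succ]
    linear_combination (norm := module) hd
  · simp only [smul_add, sum_add_distrib, sum_smul_ite_eq hi.le, sum_smul_ite_eq hi, hnorm]
    have h1 : ∑ j ∈ range (m + 1), normCoeff p n j • u • δ j =
        u • (ξ - ((e : ℤ[X]) * geomPoly (p ^ n)) • α) := by
      conv_rhs => rw [R.norm_eq, add_sub_cancel_left, smul_sum]
      exact sum_congr rfl fun j _ => smul_comm _ _ _
    have h2 : u • ξ = ξ := by
      rw [hu]
      push_cast
      linear_combination (norm := module) (w : ℤ[X]) • H.prime_smul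
    have h3 : normCoeff p n (i + 1) = (p : ℤ[X]) ^ i * geomPoly (p ^ n) := by
      rw [normCoeff, if_neg (by omega), Nat.add_sub_cancel]
    rw [h1, h3]
    linear_combination (norm := module) -h2

/-- The element `geomPoly (p ^ a) • x - f` has trivial norm to `K_a`, so Hilbert 90 writes it as
`(X^{p^a} - 1)w`, which is `geomPoly (p ^ a) * (X - 1)` applied to `w`. Hence `z = x - (X - 1)w`
satisfies `geomPoly (p ^ a) • z = f`, and applying `X - 1` puts `z` in `K_a`. -/
theorem CyclicData.exists_layer_decomposition {p n : ℕ} {ξ : M} (H : CyclicData p n ξ) {a : ℕ}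
    (ha : a < n) {x f : M} (hx : (X : ℤ[X]) ^ p ^ (a + 1) • x = x) (hf : (X : ℤ[X]) • f = f)
    (h : geomPoly (p ^ (a + 1)) • x = (p : ℤ[X]) • f) : ∃ z w : M, x = z + (X - 1 : ℤ[X]) • w ∧
      (X : ℤ[X]) ^ p ^ a • z = z ∧ (X : ℤ[X]) ^ p ^ (a + 1) • w = w := by
  have hfk : ∀ k : ℕ, (∑ j ∈ range k, ((X : ℤ[X]) ^ p ^ a) ^ j) • f = (k : ℤ[X]) • f := by
    intro k
    have h1 : ∀ k : ℕ, (X : ℤ[X]) ^ k • f = f := by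
      intro k
      induction k with
      | zero => simp
      | succ k ih => rw [pow_succ, mul_smul, hf, ih]
    rw [sum_smul]
    simp_rw [← pow_mul, h1]
    rw [sum_const, card_range, Nat.cast_smul_eq_nsmul]
  have h1 := geomPoly_smul (n := n) ha hx
  have h2 : (∑ j ∈ range (p ^ (n - a)), ((X : ℤ[X]) ^ p ^ a) ^ j) •
      (geomPoly (p ^ a) • x - f) = 0 := by
    rw [smul_sub, ← mul_smul, mul_comm, geomPoly_mul_sum ha.le, h1, hfk, mul_smul, h, ← mul_smul]
    have : n - a = n - (a + 1) + 1 := by omega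
    rw [this]
    push_cast
    rw [pow_succ, sub_self]
  obtain ⟨w, hw⟩ := H.hilbert90 a ha _ h2
  have h3 := geomPoly_mul_sub_one (p ^ a)
  refine ⟨x - (X - 1 : ℤ[X]) • w, w, by module, ?_, ?_⟩
  · have h4 := congrArg (· • x) h3
    linear_combination (norm := module) (X - 1 : ℤ[X]) • hw - h4 + hf
  · have h5 := hfk p
    have h6 := geom_sum_mul ((X : ℤ[X]) ^ p ^ a) p
    have h7 := geomPoly_mul_sum (p := p) (Nat.le_succ a)
    rw [Nat.succ_eq_add_one, Nat.add_sub_cancel_left, pow_one] at h7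
    rw [← pow_mul, ← pow_succ] at h6
    have h8 := congrArg (· • w) h6
    have h9 := congrArg (· • x) h7
    linear_combination (norm := module) (-1 : ℤ[X]) • h8 -
      (∑ j ∈ range p, ((X : ℤ[X]) ^ p ^ a) ^ j) • hw + h9 + h - h5

/-- `D` is `1 + pw` times the relative norm of `x` from `K_b` to `K_a`. That norm is `p ^ (b - a)`
modulo `X - 1`, and `b > a`; so among tight levels, those of index above `i₀` contribute nothing
modulo `X - 1` and `p`. -/
theorem exists_smul_norm_eq {p n i₀ i a b : ℕ}
    (hab : a ≤ b) (hb : b ≤ n) (hi : b + i₀ = a + i) (hi₀ : i₀ < i) (w : ℤ) {x : M}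
    (hx : (X : ℤ[X]) ^ p ^ b • x = x) :
    ∃ D : M, geomPoly (p ^ a) • D = ((1 + p * w : ℤ) : ℤ[X]) • geomPoly (p ^ b) • x ∧
      (X : ℤ[X]) ^ p ^ a • D = D ∧
      ∃ y r : M, D = (X - 1 : ℤ[X]) • y + (p : ℤ[X]) • r ∧
        (i₀ = 0 → geomPoly (p ^ (n - 1)) • D = geomPoly (p ^ n) • r) := by
  set ψ : ℤ[X] := ((1 + p * w : ℤ) : ℤ[X])
  obtain ⟨k, rfl⟩ : ∃ k, b = a + k + 1 := ⟨b - a - 1, by omega⟩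
  have hS := geomPoly_mul_sum (p := p) hab
  have hN : (X - 1 : ℤ[X]) ∣ (∑ j ∈ range (p ^ (a + k + 1 - a)), ((X : ℤ[X]) ^ p ^ a) ^ j) -
      (p : ℤ[X]) ^ (k + 1) := by
    have h1 : (∑ j ∈ range (p ^ (a + k + 1 - a)), ((X : ℤ[X]) ^ p ^ a) ^ j) - (p : ℤ[X]) ^ (k + 1) =
        ∑ j ∈ range (p ^ (a + k + 1 - a)), (((X : ℤ[X]) ^ p ^ a) ^ j - 1) := by
      have : a + k + 1 - a = k + 1 := by omega
      simp [this]
    rw [h1]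
    refine dvd_sum fun j _ => ?_
    rw [← pow_mul]
    exact sub_one_dvd_pow_sub_one _ _
  have hl := layer_sum_smul hab hx
  set S : ℤ[X] := ∑ j ∈ range (p ^ (a + k + 1 - a)), ((X : ℤ[X]) ^ p ^ a) ^ j
  obtain ⟨Y, hY⟩ := hN
  have hD : (X : ℤ[X]) ^ p ^ a • ψ • S • x = ψ • S • x := by rw [smul_comm, hl]
  refine ⟨ψ • S • x, ?_, hD, (ψ * Y) • x, (ψ * (p : ℤ[X]) ^ k) • x, ?_, ?_⟩
  · rw [← hS]; module
  · have h1 := congrArg (fun P => (ψ * P) • x) hY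
    rw [pow_succ] at h1
    linear_combination (norm := module) h1
  · intro h0
    have h1 := geomPoly_smul (n := n - 1) (by omega) hD
    have h2 := geomPoly_smul hb hx
    have h3 : n - 1 - a = k + (n - (a + k + 1)) := by omega
    rw [h3, pow_add] at h1
    have h4 := congrArg
      (fun P => ((p : ℤ[X]) ^ k * (p : ℤ[X]) ^ (n - (a + k + 1)) * ψ * P) • x) hS
    linear_combination (norm := module) h1 + h4 - (ψ * (p : ℤ[X]) ^ k) • h2

/-- If the relation attached to a representation can be divided once more by `p`, except for
the levels where the bound is attained, then the lowest such level can be lowered. -/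
theorem Rep.exists_decomposition {p n : ℕ} [hp : Fact p.Prime] {ξ : M} (H : CyclicData p n ξ)
    {m : ℕ} {L : ℕ → WithBot ℕ} (hL : Admissible n m L)
    {d e : ℤ} {α : M} {δ : ℕ → M} (R : Rep p n m ξ L d e α δ) (hreg : Regular p d) {h : ℕ}
    (hbound : ∀ i ≤ m, ∀ a : ℕ, L i = a → h + 1 + a ≤ n + i)
    (hdvd : (p : ℤ) ^ (h + 2) ∣ 1 - d ^ p ^ n) {ζ : M} (hζ : (p : ℤ[X]) ^ (h + 1) • ζ = ξ)
    (hζd : (X - (d : ℤ[X])) • ζ = 0) {i₀ a : ℕ} (hi₀ : i₀ ≤ m) (ha : L i₀ = a)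
    (hia : h + 1 + a = n + i₀)
    (hmin : ∀ i ≤ m, ∀ b : ℕ, L i = b → h + 1 + b = n + i → i₀ ≤ i) :
    ∃ (w : ℤ) (x y r : M) (l : WithBot ℕ), l < a ∧ InLayer p l x ∧
      ((1 + p * w : ℤ) : ℤ[X]) • δ i₀ = x + (X - 1 : ℤ[X]) • y + (p : ℤ[X]) • r ∧
      (i₀ = 0 → geomPoly (p ^ (n - 1)) • ((1 + p * w : ℤ) : ℤ[X]) • δ i₀ =
        geomPoly (p ^ (n - 1)) • x + geomPoly (p ^ n) • r) := by
  obtain ⟨c, hc⟩ := hdvd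
  obtain ⟨W, hW⟩ := exists_twGeomPoly_eq hreg.1 (p ^ n)
  have hterm : ∀ i, i ≤ m → _ := fun i hi =>
    exists_divided_decomposition R.eq_one_add hreg hc.symm hW (R.layer i hi) fun b hb =>
      ⟨(hL.le_of_eq hi hb).1, hbound i hi b hb, (hL.le_of_eq hi hb).2⟩
  choose! g v hy hy' hg hv w hw using hterm
  have hc' : (p : ℤ) ^ (h + 1) * (p * c) = 1 - d ^ p ^ n := by rw [hc]; ring
  obtain ⟨hη, hηξ⟩ := R.root_of_divided hp.out.ne_zero hc' hW hy hy'
  set η := ((p * c : ℤ) : ℤ[X]) • α - ∑ i ∈ range (m + 1), (g i + (p : ℤ[X]) • v i) with hηdef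
  obtain ⟨j, hj⟩ := H.exists_smul_of_pow_smul_eq_zero (ζ := (p : ℤ[X]) • ζ) (k := h) (η := η)
    (by rw [← hζ]; module) (by
      have := H.prime_smul
      linear_combination (norm := module) (p : ℤ[X]) • hηξ - this)
  -- This is the definition of `η` divided by `p` term by term. The explicit quotients `v i` give
  -- `(X - d) • z = -(e * p) • z`, and since `d = 1 + p * e`, `z` is fixed by `X`.
  set z := (c : ℤ[X]) • α - (j : ℤ[X]) • ζ - ∑ i ∈ range (m + 1), v i with hz
  have hgz : ∑ i ∈ range (m + 1), g i = (p : ℤ[X]) • z := by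
    rw [sum_add_distrib, ← smul_sum] at hηdef
    push_cast at hηdef
    linear_combination (norm := module) hηdef - hj - (p : ℤ[X]) • hz
  have hXz : (X : ℤ[X]) • z = z := by
    have h1 : (X - (d : ℤ[X])) • ∑ i ∈ range (m + 1), v i =
        (c : ℤ[X]) • (X - (d : ℤ[X])) • α + (e : ℤ[X]) • (p : ℤ[X]) • z := by
      rw [← hgz, R.sub_smul, smul_sum, smul_sum, smul_sum, ← sum_add_distrib]
      refine sum_congr rfl fun i hi => ?_
      rw [hv i (Nat.lt_succ_iff.1 (mem_range.1 hi)), mul_smul]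
    have hd := congrArg (fun k : ℤ => (k : ℤ[X]) • z) R.eq_one_add
    push_cast at hd
    have h2 := congrArg ((X - (d : ℤ[X])) • ·) hz
    simp only [smul_sub, h1] at h2
    linear_combination (norm := module) h2 - (j : ℤ[X]) • hζd + hd
  -- the summands of the norm relation, gathered in the layer `a`
  have hgath : ∀ i, i ≤ m → ∃ D : M, geomPoly (p ^ a) • D = g i ∧
      (X : ℤ[X]) ^ p ^ a • D = D ∧ (i = i₀ → D = ((1 + p * w i : ℤ) : ℤ[X]) • δ i) ∧
      (i ≠ i₀ → ∃ y r : M, D = (X - 1 : ℤ[X]) • y + (p : ℤ[X]) • r ∧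
        (i₀ = 0 → geomPoly (p ^ (n - 1)) • D = geomPoly (p ^ n) • r)) := by
    intro i hi
    rcases hw i hi with ⟨h1, h2⟩ | ⟨b, hb, hbi, h2⟩
    · have hne : i ≠ i₀ := by
        rintro rfl
        exact h1 a ha hia
      exact ⟨0, by simp [h2], by simp, fun h => (hne h).elim, fun _ => ⟨0, 0, by simp, by simp⟩⟩
    · by_cases hii : i = i₀
      · subst hii
        obtain rfl : a = b := by exact_mod_cast ha.symm.trans hb
        have hδ : (X : ℤ[X]) ^ p ^ a • δ i = δ i := by
          have := R.layer i hi
          rwa [ha] at this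
        refine ⟨_, ?_, ?_, fun _ => rfl, fun h => (h rfl).elim⟩
        · rw [h2, smul_comm]
        · rw [smul_comm, hδ]
      · have hle := hmin i hi b hb hbi
        have hδ : (X : ℤ[X]) ^ p ^ b • δ i = δ i := by
          have := R.layer i hi
          rwa [hb] at this
        obtain ⟨D, hD1, hD2, hD3⟩ := exists_smul_norm_eq (n := n) (i₀ := i₀) (i := i) (a := a)
          (by omega) (hL.le_of_eq hi hb).1 (by omega) (by omega) (w i) hδ
        exact ⟨D, by rw [hD1, h2], hD2, fun h => (hii h).elim, fun _ => hD3⟩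
  choose! D hD1 hD2 hD3 hD4 using hgath
  have hsum : ∑ i ∈ range (m + 1), D i =
      ((1 + p * w i₀ : ℤ) : ℤ[X]) • δ i₀ + ∑ i ∈ (range (m + 1)).erase i₀, D i := by
    rw [← hD3 i₀ hi₀ rfl, add_sum_erase _ _ (by simp; omega)]
  have hrest : ∃ y r : M, ∑ i ∈ (range (m + 1)).erase i₀, D i =
      (X - 1 : ℤ[X]) • y + (p : ℤ[X]) • r ∧
      (i₀ = 0 → geomPoly (p ^ (n - 1)) • ∑ i ∈ (range (m + 1)).erase i₀, D i =
        geomPoly (p ^ n) • r) := by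
    refine sum_induction D (fun D => ∃ y r : M, D = (X - 1 : ℤ[X]) • y + (p : ℤ[X]) • r ∧
      (i₀ = 0 → geomPoly (p ^ (n - 1)) • D = geomPoly (p ^ n) • r)) ?_ ⟨0, 0, by simp, by simp⟩ ?_
    · rintro _ _ ⟨y, r, rfl, h1⟩ ⟨y', r', rfl, h2⟩
      exact ⟨y + y', r + r', by module, fun h => by rw [smul_add, h1 h, h2 h, smul_add]⟩
    · intro i hi
      rw [mem_erase, mem_range] at hi
      exact hD4 i (by omega) hi.1
  obtain ⟨y₁, r₁, hr₁, hr₁'⟩ := hrest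
  have hT1 : geomPoly (p ^ a) • ∑ i ∈ range (m + 1), D i = (p : ℤ[X]) • z := by
    rw [← hgz, smul_sum]
    exact sum_congr rfl fun i hi => hD1 i (Nat.lt_succ_iff.1 (mem_range.1 hi))
  have hT2 : (X : ℤ[X]) ^ p ^ a • ∑ i ∈ range (m + 1), D i = ∑ i ∈ range (m + 1), D i := by
    rw [smul_sum]
    exact sum_congr rfl fun i hi => hD2 i (Nat.lt_succ_iff.1 (mem_range.1 hi))
  have hTT : ∃ (x y r : M) (l : WithBot ℕ), l < a ∧ InLayer p l x ∧
      ∑ i ∈ range (m + 1), D i = x + (X - 1 : ℤ[X]) • y + (p : ℤ[X]) • r ∧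
      (i₀ = 0 → geomPoly (p ^ (n - 1)) • ∑ i ∈ range (m + 1), D i =
        geomPoly (p ^ (n - 1)) • x + geomPoly (p ^ n) • r) := by
    -- The norm of `∑ D i` from layer `a` is `p • z` with `z` in the base field. For `a = 0` the sum
    -- itself is `p • z` and the level drops to `⊥`; otherwise Hilbert 90 lowers it by one.
    rcases Nat.eq_zero_or_pos a with rfl | hapos
    · have h1 : ∑ i ∈ range (m + 1), D i = (p : ℤ[X]) • z := by
        rw [← hT1]; simp [geomPoly]
      have hz1 : (X : ℤ[X]) ^ p ^ 0 • z = z := by simpa using hXz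
      refine ⟨0, 0, z, ⊥, WithBot.bot_lt_coe 0, rfl, by rw [h1]; module, fun h0 => ?_⟩
      have := (hL.le_of_eq hi₀ ha).2 h0
      rw [h1, geomPoly_smul (Nat.zero_le n) hz1, smul_comm,
        geomPoly_smul (Nat.zero_le (n - 1)) hz1, smul_zero, zero_add, ← mul_smul, ← mul_assoc,
        ← pow_succ']
      congr 4
      omega
    · obtain ⟨a, rfl⟩ := Nat.exists_eq_succ_of_ne_zero hapos.ne'
      have han := hL.le_of_eq hi₀ ha
      obtain ⟨x, y, h1, h2, h3⟩ := H.exists_layer_decomposition han.1 hT2 hXz hT1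
      refine ⟨x, y, 0, (a : ℕ), by exact_mod_cast Nat.lt_succ_self a, h2, by rw [h1]; module,
        fun h0 => ?_⟩
      have h4 := han.2 h0
      have h5 : geomPoly (p ^ (n - 1)) • (X - 1 : ℤ[X]) • y = 0 := by
        rw [← mul_smul, geomPoly_mul_sub_one]
        exact X_pow_sub_one_smul (X_pow_smul_of_le (by omega) h3)
      rw [h1]
      linear_combination (norm := module) h5
  obtain ⟨x, y, r, l, hl, hxl, hT3, hT4⟩ := hTT
  refine ⟨w i₀, x, y - y₁, r - r₁, l, hl, hxl, ?_, fun h0 => ?_⟩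
  · linear_combination (norm := module) hT3 - hsum - hr₁
  · have h1 := congrArg (geomPoly (p ^ (n - 1)) • ·) hsum
    linear_combination (norm := module) hT4 h0 - h1 - hr₁' h0

/-! ### The divisibility bound and its improvement. -/

theorem pow_mul_sub_one_dvd {p : ℕ} {d : ℤ} (hd : (p : ℤ) ∣ d - 1) (n : ℕ) :
    (p : ℤ) ^ n * (d - 1) ∣ 1 - d ^ p ^ n := by
  obtain ⟨ψ, hψ⟩ := pow_dvd_sum_pow hd n
  refine ⟨-ψ, ?_⟩
  have := geom_sum_mul d (p ^ n)
  rw [hψ] at this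
  linear_combination this

/-- The equation of a representation with these levels can be divided by `p ^ h`. -/
structure DivBound (p n m : ℕ) (L : ℕ → WithBot ℕ) (d : ℤ) (h : ℕ) : Prop where
  le : ∀ i ≤ m, ∀ a : ℕ, L i = a → h + a ≤ n + i
  dvd : (p : ℤ) ^ h ∣ p ^ n * (d - 1)

theorem Rep.dvd_sub_one {p n m : ℕ} {ξ : M} {L : ℕ → WithBot ℕ} {d e : ℤ} {α : M} {δ : ℕ → M}
    (R : Rep p n m ξ L d e α δ) : (p : ℤ) ∣ d - 1 := ⟨e, by rw [R.eq_one_add]; ring⟩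

theorem Rep.exists_root {p n : ℕ} [hp : Fact p.Prime] {ξ : M}
    {m : ℕ} {L : ℕ → WithBot ℕ} (hL : Admissible n m L)
    {d e : ℤ} {α : M} {δ : ℕ → M} (R : Rep p n m ξ L d e α δ) {h : ℕ}
    (hB : DivBound p n m L d (h + 1)) :
    ∃ (c : ℤ) (f z : M), (p : ℤ) ^ (h + 1) * c = 1 - d ^ p ^ n ∧ (X : ℤ[X]) • f = f ∧
      (X - (d : ℤ[X])) • ((c : ℤ[X]) • α - f - (p : ℤ[X]) • z) = 0 ∧
      (p : ℤ[X]) ^ h • ((c : ℤ[X]) • α - f - (p : ℤ[X]) • z) = -ξ := by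
  obtain ⟨c, hc⟩ := hB.dvd.trans (pow_mul_sub_one_dvd R.dvd_sub_one n)
  obtain ⟨W, hW⟩ := exists_twGeomPoly_eq R.dvd_sub_one (p ^ n)
  have hterm : ∀ i, i ≤ m → _ := fun i hi =>
    exists_divided R.dvd_sub_one hc.symm hW (R.layer i hi) fun b hb =>
      ⟨(hL.le_of_eq hi hb).1, hB.le i hi b hb, (hL.le_of_eq hi hb).2⟩
  choose! y hy hy' f z hyf hf using hterm
  have h1 := R.root_of_divided hp.out.ne_zero hc.symm hW hy hy'
  have h2 : ∑ i ∈ range (m + 1), y i =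
      ∑ i ∈ range (m + 1), f i + (p : ℤ[X]) • ∑ i ∈ range (m + 1), z i := by
    rw [smul_sum, ← sum_add_distrib]
    exact sum_congr rfl fun i hi => hyf i (Nat.lt_succ_iff.1 (mem_range.1 hi))
  rw [h2, ← sub_sub] at h1
  refine ⟨c, _, _, hc.symm, ?_, h1⟩
  rw [smul_sum]
  exact sum_congr rfl fun i hi => hf i (Nat.lt_succ_iff.1 (mem_range.1 hi))

/-- The element `α` of a representation does not lie in the base field modulo `p`. -/
theorem Rep.not_fixed_add_smul {p n : ℕ} (hn : 1 ≤ n) {ξ : M} (H : CyclicData p n ξ)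
    {m : ℕ} {L : ℕ → WithBot ℕ} {d e : ℤ} {α : M} {δ : ℕ → M} (R : Rep p n m ξ L d e α δ)
    (h0 : δ 0 = 0) {f z : M} (hf : (X : ℤ[X]) • f = f) (hα : α = f + (p : ℤ[X]) • z) : False := by
  have hsub := R.sub_smul
  have hnorm := R.norm_eq
  rw [sum_range_succ', h0, smul_zero, add_zero] at hsub hnorm
  set z₀ := ∑ i ∈ range m, (p : ℤ[X]) ^ i • δ (i + 1) with hz₀
  have h1 : ∑ i ∈ range m, (p : ℤ[X]) ^ (i + 1) • δ (i + 1) = (p : ℤ[X]) • z₀ := by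
    rw [hz₀, smul_sum]
    exact sum_congr rfl fun i _ => by rw [pow_succ']; module
  have h2 : ∑ i ∈ range m, normCoeff p n (i + 1) • δ (i + 1) = geomPoly (p ^ n) • z₀ := by
    rw [hz₀, smul_sum]
    refine sum_congr rfl fun i _ => ?_
    rw [normCoeff, if_neg (by omega), Nat.add_sub_cancel]
    module
  have hd := R.eq_one_add
  have hd' := congrArg (Int.cast : ℤ → ℤ[X]) hd
  push_cast at hd'
  rw [h1] at hsub
  rw [h2] at hnorm
  -- Substituting `α = f + p • z` shows that this element is killed by `p`, hence a multiple of `ξ`,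
  -- whose norm is zero. Taking norms cancels the whole right side of the norm equation and leaves
  -- `ξ = 0`.
  obtain ⟨j, hj⟩ := H.torsion (z₀ + (e : ℤ[X]) • f - (X - (d : ℤ[X])) • z) (by
    rw [hα] at hsub
    have h3 := congrArg (· • f) hd'
    linear_combination (norm := module) (-1 : ℤ[X]) • hsub + hf - h3)
  have h3 : geomPoly (p ^ n) • ξ = 0 := by
    have hξ : (X : ℤ[X]) ^ p ^ 0 • ξ = ξ := by simpa using H.fixed
    obtain ⟨n, rfl⟩ := Nat.exists_eq_add_of_le' hn
    rw [geomPoly_smul (Nat.zero_le _) hξ, Nat.sub_zero, pow_succ, mul_right_comm, mul_smul,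
      H.prime_smul, smul_zero]
  have h4 := H.geomPoly_smul_mul (X - (d : ℤ[X])) z
  simp only [eval_sub, eval_X, eval_intCast, Int.cast_sub, Int.cast_one, Int.cast_id] at h4
  have h5 := congrArg (geomPoly (p ^ n) • ·) hj
  have h6 := congrArg (· • geomPoly (p ^ n) • z) hd'
  have h7 := congrArg (((e : ℤ[X]) * geomPoly (p ^ n)) • ·) hα
  refine H.ne_zero ?_
  linear_combination (norm := module) hnorm + h5 + (j : ℤ[X]) • h3 + h4 - h6 + h7

/-- Failure forces `n ≤ h`, hence `δ 0 = 0`, and makes `c` prime to `p`. The attached root `η` is a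
multiple of `p • ζ`, so `c • α`, and with it `α`, is a base field element plus a multiple of `p`,
which `Rep.not_fixed_add_smul` excludes. -/
theorem Rep.pow_dvd_of_root {p n : ℕ} [hp : Fact p.Prime] (hn : 1 ≤ n) {ξ : M}
    (H : CyclicData p n ξ) {m : ℕ} (hm : 1 ≤ m) {L : ℕ → WithBot ℕ} (hL : Admissible n m L)
    {d e : ℤ} {α : M} {δ : ℕ → M} (R : Rep p n m ξ L d e α δ) {h : ℕ}
    (hreg : n ≤ h → Regular p d) (hB : DivBound p n m L d (h + 1)) {ζ : M}
    (hζ : (p : ℤ[X]) ^ (h + 1) • ζ = ξ) : (p : ℤ) ^ (h + 2) ∣ p ^ n * (d - 1) := by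
  by_contra hndvd
  have hnh : n ≤ h := by
    by_contra hlt
    refine hndvd ((pow_dvd_pow (p : ℤ) (by omega : h + 2 ≤ n + 1)).trans ?_)
    rw [pow_succ]
    exact mul_dvd_mul_left _ R.dvd_sub_one
  have hreg := hreg hnh
  have hp' : Prime (p : ℤ) := Nat.prime_iff_prime_int.1 hp.out
  have hδ0 : δ 0 = 0 := by
    have h0 := R.layer 0 (by omega)
    cases hl : L 0 with
    | bot => rwa [hl] at h0
    | coe a =>
      have := hB.le 0 (by omega) a hl
      omega
  obtain ⟨c, f, z, hc, hf, -, hηξ⟩ := R.exists_root hL hB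
  set η := (c : ℤ[X]) • α - f - (p : ℤ[X]) • z with hη
  obtain ⟨j, hj⟩ := H.exists_smul_of_pow_smul_eq_zero (ζ := (p : ℤ[X]) • ζ) (k := h) (η := η)
    (by rw [← hζ]; module) (by
      have := H.prime_smul
      linear_combination (norm := module) (p : ℤ[X]) • hηξ - this)
  have hpc : ¬ (p : ℤ) ∣ c := by
    rintro ⟨b, rfl⟩
    obtain ⟨w, hw⟩ := hreg.sum_pow_eq n
    have h1 := geom_sum_mul d (p ^ n)
    rw [hw] at h1
    have hcop : IsCoprime ((p : ℤ) ^ (h + 2)) (1 + p * w) := by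
      refine IsCoprime.pow_left ⟨-w, 1, by ring⟩
    refine hndvd (hcop.dvd_of_dvd_mul_left ⟨-b, ?_⟩)
    linear_combination h1 + hc
  obtain ⟨u, v, huv⟩ := (hp'.coprime_iff_not_dvd.2 hpc).symm
  have huv' := congrArg (fun k : ℤ => (k : ℤ[X]) • α) huv
  push_cast at huv'
  refine R.not_fixed_add_smul hn H hδ0 (f := (u : ℤ[X]) • f)
    (z := (u : ℤ[X]) • z + ((u * j : ℤ) : ℤ[X]) • ζ + (v : ℤ[X]) • α) (by rw [smul_comm, hf]) ?_
  push_cast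
  linear_combination (norm := module) (u : ℤ[X]) • hj - huv' - (u : ℤ[X]) • hη

/-- Either the bound improves, or some level can be lowered. -/
theorem Rep.divBound_succ_or_lower {p n : ℕ} [hp : Fact p.Prime] (hn : 1 ≤ n) {ξ : M}
    (H : CyclicData p n ξ) {m : ℕ} {L : ℕ → WithBot ℕ} (hL : Admissible n m L)
    {d e : ℤ} {α : M} {δ : ℕ → M} (R : Rep p n m ξ L d e α δ) {h : ℕ} (hm : h + 1 < m)
    (hB : DivBound p n m L d (h + 1)) {ζ : M} (hζ : (p : ℤ[X]) ^ (h + 1) • ζ = ξ)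
    (h4 : p = 2 → ∀ x : M, (4 : ℤ[X]) • x = 0 → (X : ℤ[X]) • x = x) :
    DivBound p n m L d (h + 2) ∨ ∃ i < m, ∃ a : ℕ, L i = a ∧ ∃ l < (a : WithBot ℕ),
      ∃ d' e' α' δ', Rep p n m ξ (fun j => if j < i then L j else if j = i then l else n)
        d' e' α' δ' := by
  obtain ⟨c, f, z, -, -, hη, hηξ⟩ := R.exists_root hL hB
  set η := (c : ℤ[X]) • α - f - (p : ℤ[X]) • z
  obtain ⟨j, hj⟩ := H.exists_smul_of_pow_smul_eq_zero (ζ := (p : ℤ[X]) • ζ) (k := h) (η := η)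
    (by rw [← hζ]; module) (by
      have := H.prime_smul
      linear_combination (norm := module) (p : ℤ[X]) • hηξ - this)
  obtain ⟨ζ', hζ'⟩ : ∃ ζ' : M, ζ' = (-j : ℤ[X]) • ζ := ⟨_, rfl⟩
  have hηζ : η = -((p : ℤ[X]) • ζ') := by
    rw [hζ', hj]; module
  have hζξ : (p : ℤ[X]) ^ (h + 1) • ζ' = ξ := by
    rw [hηζ] at hηξ
    linear_combination (norm := module) (-1 : ℤ[X]) • hηξ
  obtain ⟨i, hi⟩ := H.torsion ((X - (d : ℤ[X])) • ζ') (by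
    rw [hηζ] at hη
    linear_combination (norm := module) (-1 : ℤ[X]) • hη)
  -- `X` acts on `p • ζ'` through `d`, so on `ζ'` the discrepancy is `i • ξ = (i * p ^ (h + 1)) •
  -- ζ'`, which `d₁` incorporates.
  set d₁ : ℤ := d + i * p ^ (h + 1) with hd₁
  have hζd : (X - (d₁ : ℤ[X])) • ζ' = 0 := by
    rw [hd₁]
    push_cast
    linear_combination (norm := module) hi - (i : ℤ[X]) • hζξ
  have hd₁e : d₁ = 1 + p * (e + i * p ^ h) := by rw [hd₁, R.eq_one_add]; ring
  have hreg₁ : Regular p d₁ := by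
    refine ⟨⟨e + i * p ^ h, by rw [hd₁e]; ring⟩, fun hp2 => ?_⟩
    -- For `p = 2` this is an element of order 4; as `X` fixes it, `d₁ ≡ 1` modulo 4.
    have h5 := h4 hp2 ((p : ℤ[X]) ^ h • ζ') (by
      have h6 := H.prime_smul
      subst hp2
      push_cast at hζξ h6 ⊢
      linear_combination (norm := module) (2 : ℤ[X]) • hζξ + h6)
    have h7 : (((d₁ - 1) * p ^ h : ℤ) : ℤ[X]) • ζ' = 0 := by
      push_cast
      linear_combination (norm := module) h5 - (p : ℤ[X]) ^ h • hζd
    have h8 := H.pow_dvd_of_smul_eq_zero hζξ h7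
    have hp0 : (p : ℤ) ^ h ≠ 0 := pow_ne_zero _ (Nat.cast_ne_zero.2 hp.out.ne_zero)
    have h9 : (p : ℤ) ^ (h + 1 + 1) = p ^ 2 * p ^ h := by ring
    rw [h9] at h8
    have h10 := Int.dvd_of_mul_dvd_mul_right hp0 h8
    rw [hp2] at h10
    exact_mod_cast h10
  have hdvd : (p : ℤ) ^ (h + 2) ∣ p ^ n * (d - 1) := by
    refine R.pow_dvd_of_root hn H (by omega) hL (fun hnh => ⟨R.dvd_sub_one, fun hp2 => ?_⟩) hB hζ
    have h5 : (4 : ℤ) ∣ p ^ (h + 1) := by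
      obtain ⟨k, hk⟩ : ∃ k, h + 1 = k + 2 := ⟨h - 1, by omega⟩
      rw [hk, hp2, pow_add]
      exact ⟨2 ^ k, by push_cast; ring⟩
    have h6 : d - 1 = (d₁ - 1) - i * p ^ (h + 1) := by rw [hd₁]; ring
    rw [h6]
    exact dvd_sub (hreg₁.2 hp2) (h5.mul_left _)
  by_cases hS : ∃ i, i ≤ m ∧ ∃ b : ℕ, L i = b ∧ h + 1 + b = n + i
  · right
    classical
    obtain ⟨hi₀, a, ha, hia⟩ := Nat.find_spec hS
    have hmin : ∀ i ≤ m, ∀ b : ℕ, L i = b → h + 1 + b = n + i → Nat.find hS ≤ i :=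
      fun i hi b hb hbi => Nat.find_min' hS ⟨hi, b, hb, hbi⟩
    generalize Nat.find hS = i₀ at *
    have hi₀m : i₀ < m := by
      refine lt_of_le_of_ne hi₀ ?_
      rintro rfl
      rw [hL.top] at ha
      have : n = a := by exact_mod_cast ha
      omega
    -- Tightness at `i₀` is exactly the condition under which layer `a` absorbs a change of `d`
    -- modulo `p ^ (h + 1)`.
    obtain ⟨α₁, δ₁, R₁⟩ := R.exists_of_modEq H (by omega) hL hi₀ ha hia.ge hd₁e
      ⟨i, by rw [hd₁]; ring⟩ (Or.inr hreg₁)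
    have hdvd₁ : (p : ℤ) ^ (h + 2) ∣ 1 - d₁ ^ p ^ n := by
      refine dvd_trans ?_ (pow_mul_sub_one_dvd hreg₁.1 n)
      have h5 : (p : ℤ) ^ n * (d₁ - 1) = p ^ n * (d - 1) + i * (p ^ (n + (h + 1))) := by
        rw [hd₁]; ring
      rw [h5]
      exact dvd_add hdvd ((pow_dvd_pow _ (by omega)).mul_left _)
    obtain ⟨w, x, y, r, l, hl, hxl, h5, h6⟩ := R₁.exists_decomposition H hL hreg₁ hB.le hdvd₁ hζξ
      hζd hi₀ ha hia hmin
    exact ⟨i₀, hi₀m, a, ha, l, hl, _, _, R₁.exists_lower H hi₀m h5 h6 hxl⟩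
  · left
    refine ⟨fun i hi a ha => ?_, hdvd⟩
    have h5 := hB.le i hi a ha
    have h6 : h + 1 + a ≠ n + i := fun h6 => hS ⟨i, hi, a, ha, h6⟩
    omega

/-- For representations that are minimal in the lexicographic ordering of the levels, the
equation can be divided by `p ^ (k + 1)` when there are roots of unity of this order. -/
theorem Rep.divBound_of_minimal {p n : ℕ} [hp : Fact p.Prime] (hn : 1 ≤ n) {ξ : M}
    (H : CyclicData p n ξ) {m : ℕ} {L : ℕ → WithBot ℕ} (hL : Admissible n m L)
    {d e : ℤ} {α : M} {δ : ℕ → M} (R : Rep p n m ξ L d e α δ)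
    (hmin : ∀ i < m, ∀ a : ℕ, L i = a → ∀ l < (a : WithBot ℕ), ∀ d' e' α' δ',
      ¬ Rep p n m ξ (fun j => if j < i then L j else if j = i then l else n) d' e' α' δ')
    {k : ℕ} (hkm : k < m) {ζ : M} (hζ : (p : ℤ[X]) ^ k • ζ = ξ)
    (h4 : 1 ≤ k → p = 2 → ∀ x : M, (4 : ℤ[X]) • x = 0 → (X : ℤ[X]) • x = x) :
    DivBound p n m L d (k + 1) := by
  induction k generalizing ζ with
  | zero =>
    refine ⟨fun i hi a ha => ?_, ?_⟩
    · obtain ⟨h1, h2⟩ := hL.le_of_eq hi ha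
      rcases Nat.eq_zero_or_pos i with h | h
      · have := h2 h; omega
      · omega
    · rw [zero_add, pow_one]
      exact R.dvd_sub_one.mul_left _
  | succ k ih =>
    have h1 := ih (ζ := (p : ℤ[X]) • ζ) (by omega) (by rw [← hζ]; module)
      fun _ => h4 (by omega)
    rcases R.divBound_succ_or_lower hn H hL hkm h1 hζ (h4 (by omega)) with h2 | h2
    · exact h2
    · obtain ⟨i, hi, a, ha, l, hl, d', e', α', δ', h3⟩ := h2
      exact (hmin i hi a ha l hl d' e' α' δ' h3).elim

/-! ### Changing `d` beyond the available roots of unity. -/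

/-- Take `α = u • ζ` and all `δ i = 0`. As `X` acts on `ζ` through `d`, the norm multiplies `ζ` by
`p ^ n * (1 + p * w)`, so the norm equation reads `ξ = (u * t) • ξ` with `t = p ^ n * (d - 1) / p ^
(k + 1)`. Exact divisibility makes `t` prime to `p`, and `u` is its inverse modulo `p`. -/
theorem CyclicData.exists_rep_of_root {p n m : ℕ} [hp : Fact p.Prime] {ξ : M}
    (H : CyclicData p n ξ) (L : ℕ → WithBot ℕ) {d e : ℤ} (hd : d = 1 + p * e) (hreg : Regular p d)
    {k : ℕ} (hdvd : (p : ℤ) ^ (k + 1) ∣ p ^ n * (d - 1))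
    (hndvd : ¬ (p : ℤ) ^ (k + 2) ∣ p ^ n * (d - 1)) {ζ : M} (hζ : (p : ℤ[X]) ^ k • ζ = ξ)
    (hζd : (X - (d : ℤ[X])) • ζ = 0) : ∃ α δ, Rep p n m ξ L d e α δ := by
  have hp0 : (p : ℤ) ≠ 0 := Nat.cast_ne_zero.2 hp.out.ne_zero
  obtain ⟨t, ht⟩ := hdvd
  have hpt : ¬ (p : ℤ) ∣ t := by
    rintro ⟨b, rfl⟩
    exact hndvd ⟨b, by rw [ht]; ring⟩
  obtain ⟨u, v, huv⟩ := ((Nat.prime_iff_prime_int.1 hp.out).coprime_iff_not_dvd.2 hpt).symm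
  obtain ⟨w, hw⟩ := hreg.sum_pow_eq n
  have het : e * p ^ n = p ^ k * t := by
    apply mul_left_cancel₀ hp0
    rw [hd] at ht
    linear_combination ht
  have hgeom : geomPoly (p ^ n) • ζ = (((p : ℤ) ^ n * (1 + p * w) : ℤ) : ℤ[X]) • ζ := by
    refine smul_eq_smul_of_dvd hζd ?_
    rw [← hw, geomPoly]
    push_cast
    rw [← sum_sub_distrib]
    exact dvd_sum fun j _ => sub_dvd_pow_sub_pow _ _ _
  refine ⟨(u : ℤ[X]) • ζ, 0, hd, fun i _ => InLayer.zero _, ?_, ?_⟩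
  · simp [smul_comm _ (u : ℤ[X]) ζ, hζd]
  · simp only [Pi.zero_apply, smul_zero, sum_const_zero, add_zero]
    have h1 := congrArg (fun j : ℤ => ((j : ℤ[X]) * ((u : ℤ[X]) * (1 + (p : ℤ[X]) * w))) • ζ) het
    have h2 := congrArg (fun j : ℤ => (j : ℤ[X]) • ξ) huv
    have h3 := H.prime_smul
    push_cast at h1 h2 hgeom
    linear_combination (norm := module) (-((e : ℤ[X]) * u)) • hgeom - h1 - h2 -
      ((u : ℤ[X]) * t * (1 + (p : ℤ[X]) * w)) • hζ + (v - (u : ℤ[X]) * t * w) • h3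

/-- If `ξ` is not divisible by `p ^ (k + 1)`, then `d` may be changed modulo `p ^ (k + 1)`. -/
theorem Rep.exists_of_not_divisible {p n m : ℕ} [hp : Fact p.Prime] {ξ : M}
    (H : CyclicData p n ξ) (hn : 1 ≤ n) (hm : 1 ≤ m) {L : ℕ → WithBot ℕ} (hL : Admissible n m L)
    {d e : ℤ} {α : M} {δ : ℕ → M} (R : Rep p n m ξ L d e α δ) {k : ℕ}
    (hB : DivBound p n m L d (k + 1)) {ζ : M} (hζ : (p : ℤ[X]) ^ k • ζ = ξ)
    (hζd : (X - (d : ℤ[X])) • ζ = 0) (hξ : ∀ x : M, (p : ℤ[X]) ^ (k + 1) • x ≠ ξ)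
    {d' : ℤ} (hreg : Regular p d') (hdd : (p : ℤ) ^ (k + 1) ∣ d' - d) :
    ∃ e' α' δ', Rep p n m ξ L d' e' α' δ' := by
  obtain ⟨e', he'⟩ := hreg.1
  have hd' : d' = 1 + p * e' := by linarith
  refine ⟨e', ?_⟩
  by_cases hex : ∃ i ≤ m, ∃ b : ℕ, L i = b ∧ n + i ≤ k + 1 + b
  · obtain ⟨i, hi, b, hb, hs⟩ := hex
    exact R.exists_of_modEq H hm hL hi hb hs hd' hdd (Or.inr hreg)
  push Not at hex
  -- No level is tight now, so this divisibility would improve the bound and produce a root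
  -- contradicting `hξ`.
  have hndvd : ¬ (p : ℤ) ^ (k + 2) ∣ p ^ n * (d - 1) := by
    intro hdvd
    have hB' : DivBound p n m L d (k + 1 + 1) := ⟨fun i hi b hb => by
      have := hex i hi b hb
      omega, hdvd⟩
    obtain ⟨c, f, z, -, -, -, h⟩ := R.exists_root hL hB'
    exact hξ (-((c : ℤ[X]) • α - f - (p : ℤ[X]) • z)) (by rw [smul_neg, h, neg_neg])
  have hdd' : (p : ℤ) ^ (k + 2) ∣ p ^ n * (d' - d) := by
    rw [pow_succ', ← pow_one (p : ℤ), ← pow_mul, one_mul, pow_one]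
    exact mul_dvd_mul (dvd_pow_self _ (by omega)) hdd
  have hsplit : (p : ℤ) ^ n * (d' - 1) = p ^ n * (d' - d) + p ^ n * (d - 1) := by ring
  refine H.exists_rep_of_root L hd' hreg (k := k) ?_ ?_ hζ ?_
  · rw [hsplit]
    exact dvd_add ((pow_dvd_pow _ (by omega)).trans hdd') hB.dvd
  · rwa [hsplit, dvd_add_right hdd']
  · obtain ⟨c, hc⟩ := hdd
    have h1 := H.prime_smul
    have hc' : (d' : ℤ[X]) = d + p ^ (k + 1) * c := by
      rw [← sub_add_cancel d' d, hc]
      push_cast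
      ring
    rw [hc']
    linear_combination (norm := module) hζd - (c * p : ℤ[X]) • hζ - (c : ℤ[X]) • h1

theorem min_emultiplicity_congr {p x y : ℤ} {m : ℕ} (h : ∀ k ≤ m, p ^ k ∣ x ↔ p ^ k ∣ y) :
    min (emultiplicity p x) (m : ℕ∞) = min (emultiplicity p y) (m : ℕ∞) := by
  refine ENat.eq_of_forall_natCast_le_iff fun k => ?_
  simp only [le_min_iff, ← pow_dvd_iff_le_emultiplicity, Nat.cast_le]
  constructor
  · exact fun hk => ⟨(h k hk.2).1 hk.1, hk.2⟩
  · exact fun hk => ⟨(h k hk.2).2 hk.1, hk.2⟩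

end Module

/-! ### Norms, Hilbert 90 and the unit group as a `ℤ[X]`-module. -/

section UnitGroup

section Norm

theorem algebraMap_norm_eq_prod_range {E L : Type*} [Field E] [Field L] [Algebra E L]
    [FiniteDimensional E L] [IsGalois E L] {g : Gal(L/E)}
    (hg : ∀ τ : Gal(L/E), τ ∈ Subgroup.zpowers g) {r : ℕ} (hr : orderOf g = r) (x : L) :
    algebraMap E L (Algebra.norm E x) = ∏ j ∈ range r, (g ^ j) x := by
  classical
  rw [Algebra.norm_eq_prod_automorphisms]
  symm
  refine prod_bij (fun j _ => g ^ j) (fun _ _ => mem_univ _) ?_ ?_ fun _ _ => rfl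
  · intro i hi j hj hij
    rw [mem_range, ← hr] at hi hj
    exact pow_injOn_Iio_orderOf hi hj hij
  · intro τ _
    have := mem_zpowers_iff_mem_range_orderOf.1 (hg τ)
    rw [hr, mem_image] at this
    obtain ⟨j, hj, h⟩ := this
    exact ⟨j, hj, h⟩

end Norm

variable {F K : Type*} [Field F] [Field K] [Algebra F K]

/-- The multiplicative group of `K`, written additively, as a `ℤ[X]`-module on which `X` acts
through `σ`. -/
def GalUnits (_σ : Gal(K/F)) : Type _ := Additive Kˣ

namespace GalUnits

variable {σ : Gal(K/F)}

instance : AddCommGroup (GalUnits σ) := inferInstanceAs (AddCommGroup (Additive Kˣ))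

/-- The action of `σ` on units. -/
def endo (σ : Gal(K/F)) : Module.End ℤ (GalUnits σ) :=
  (MonoidHom.toAdditive (Units.map (σ : K →* K))).toIntLinearMap

noncomputable instance : Module ℤ[X] (GalUnits σ) :=
  Module.compHom (GalUnits σ) (aeval (endo σ) : ℤ[X] →ₐ[ℤ] Module.End ℤ (GalUnits σ)).toRingHom

/-- The element of `K` underlying an element of `GalUnits σ`. -/
def val (x : GalUnits σ) : K := ((Additive.toMul (α := Kˣ) x : Kˣ) : K)

/-- A unit of `K`, as an element of `GalUnits σ`. -/
def of (σ : Gal(K/F)) (u : Kˣ) : GalUnits σ := Additive.ofMul u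

/-- The unit of `K` underlying an element of `GalUnits σ`. -/
def toUnit (x : GalUnits σ) : Kˣ := Additive.toMul (α := Kˣ) x

@[simp] theorem coe_toUnit (x : GalUnits σ) : (toUnit x : K) = val x := rfl

@[simp] theorem val_of (u : Kˣ) : val (of σ u) = u := rfl

theorem toUnit_of (u : Kˣ) : toUnit (of σ u) = u := rfl

theorem val_injective : Function.Injective (val : GalUnits σ → K) := fun _ _ h => Units.ext h

@[simp] theorem val_zero : val (0 : GalUnits σ) = 1 := rfl

@[simp] theorem val_add (x y : GalUnits σ) : val (x + y) = val x * val y := rfl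

theorem val_sum {ι : Type*} (s : Finset ι) (f : ι → GalUnits σ) :
    val (∑ i ∈ s, f i) = ∏ i ∈ s, val (f i) := by
  classical
  induction s using Finset.induction_on with
  | empty => simp
  | insert a s ha ih => rw [sum_insert ha, prod_insert ha, val_add, ih]

@[simp] theorem val_X_smul (x : GalUnits σ) : val ((X : ℤ[X]) • x) = σ (val x) := by
  change val ((aeval (endo σ) (X : ℤ[X])) x) = _
  rw [aeval_X]
  rfl

@[simp] theorem val_X_pow_smul (k : ℕ) (x : GalUnits σ) :
    val ((X : ℤ[X]) ^ k • x) = (σ ^ k) (val x) := by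
  induction k with
  | zero => simp
  | succ k ih => rw [pow_succ', mul_smul, val_X_smul, ih, pow_succ']; rfl

@[simp] theorem val_intCast_smul (k : ℤ) (x : GalUnits σ) : val ((k : ℤ[X]) • x) = val x ^ k := by
  rw [Int.cast_smul_eq_zsmul]
  exact Units.val_zpow_eq_zpow_val _ _

@[simp] theorem val_natCast_smul (k : ℕ) (x : GalUnits σ) : val ((k : ℤ[X]) • x) = val x ^ k := by
  have := val_intCast_smul (k : ℤ) x
  rwa [Int.cast_natCast, zpow_natCast] at this

theorem val_natCast_pow_smul (k l : ℕ) (x : GalUnits σ) :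
    val ((k : ℤ[X]) ^ l • x) = val x ^ k ^ l := by
  rw [← Nat.cast_pow, val_natCast_smul]

theorem val_geomPoly_smul (k : ℕ) (x : GalUnits σ) :
    val (geomPoly k • x) = ∏ j ∈ range k, (σ ^ j) (val x) := by
  rw [geomPoly, sum_smul, val_sum]
  exact prod_congr rfl fun j _ => val_X_pow_smul j x

end GalUnits

variable {p n : ℕ} {σ : Gal(K/F)}

theorem orderOf_eq_of_mulEquiv
    (hG : Nonempty (Gal(K/F) ≃* Multiplicative (ZMod (p ^ n))))
    (hσ : ∀ τ : Gal(K/F), τ ∈ Subgroup.zpowers σ) : orderOf σ = p ^ n := by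
  obtain ⟨f⟩ := hG
  rw [orderOf_eq_card_of_forall_mem_zpowers hσ, Nat.card_congr f.toEquiv]
  exact Nat.card_zmod _

theorem mem_cyclicLayer {i : ℕ} {x : K} : x ∈ cyclicLayer p σ i ↔ (σ ^ p ^ i) x = x := by
  rw [cyclicLayer, IntermediateField.mem_fixedField_iff]
  constructor
  · exact fun h => h _ (Subgroup.mem_zpowers _)
  · intro h τ hτ
    have : Subgroup.zpowers (σ ^ p ^ i) ≤ MulAction.stabilizer Gal(K/F) x := by
      rw [Subgroup.zpowers_le]
      exact h
    exact this hτ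

/-- Hilbert's theorem 90 for the powers of an automorphism. -/
theorem exists_map_eq_mul_of_prod_eq_one {θ : Gal(K/F)} {r : ℕ} (hr : orderOf θ = r) (hr0 : 0 < r)
    {x : K} (hx : ∏ j ∈ range r, (θ ^ j) x = 1) : ∃ y : Kˣ, θ (y : K) = x * y := by
  set c : ℕ → K := fun i => ∏ j ∈ range i, (θ ^ j) x⁻¹ with hc
  have hcr : c r = 1 := by simp only [hc, map_inv₀, prod_inv_distrib, hx, inv_one]
  have hc0 : c 0 = 1 := by simp [hc]
  have hx0 : x ≠ 0 := by
    rintro rfl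
    rw [prod_eq_zero (mem_range.2 hr0) (map_zero (θ ^ 0))] at hx
    exact zero_ne_one hx
  -- A Lagrange resolvent, nonzero for some `y` by independence of characters. The cocycle `c` is
  -- built from `x⁻¹` so that `θ` multiplies the resolvent by `x`.
  obtain ⟨y, hy⟩ : ∃ y, ∑ i ∈ range r, c i * (θ ^ i) y ≠ 0 := by
    by_contra! hall
    have hli : LinearIndependent K (fun i : Fin r => ((θ ^ (i : ℕ) : Gal(K/F)) : K → K)) :=
      (linearIndependent_monoidHom K K).comp
        (fun i : Fin r => ((θ ^ (i : ℕ) : Gal(K/F)) : K →* K)) fun i j hij => by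
          ext
          refine pow_injOn_Iio_orderOf (i.2.trans_eq hr.symm) (j.2.trans_eq hr.symm) (AlgEquiv.ext fun y => ?_)
          exact DFunLike.congr_fun hij y
    have h1 := Fintype.linearIndependent_iff.1 hli (fun i => c i) (by
      ext y
      rw [Finset.sum_apply]
      simp only [Pi.smul_apply, smul_eq_mul, Pi.zero_apply]
      rw [← hall y, Finset.sum_range])
    have h2 := h1 ⟨0, hr0⟩
    rw [hc0] at h2
    exact one_ne_zero h2
  refine ⟨Units.mk0 _ hy, ?_⟩
  rw [Units.val_mk0]
  have hstep : ∀ i, θ (c i * (θ ^ i) y) = x * (c (i + 1) * (θ ^ (i + 1)) y) := by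
    intro i
    have h1 : θ (c i) = x * c (i + 1) := by
      simp only [hc, prod_range_succ' _ i, map_prod, pow_zero, AlgEquiv.one_apply]
      rw [mul_comm, mul_assoc, inv_mul_cancel₀ hx0, mul_one]
      exact prod_congr rfl fun j _ => by rw [pow_succ']; rfl
    rw [map_mul, h1, pow_succ', mul_assoc]
    rfl
  rw [map_sum]
  simp_rw [hstep]
  rw [← mul_sum]
  congr 1
  have h1 := sum_range_succ (fun i => c i * (θ ^ i) y) r
  rw [sum_range_succ', hcr, ← hr, pow_orderOf_eq_one, hr, hc0, pow_zero] at h1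
  exact add_right_cancel h1

theorem hilbert90_cyclicLayer (hp : p ≠ 0) (hord : orderOf σ = p ^ n) {b : ℕ} (hb : b < n) {x : K}
    (hx : ∏ j ∈ range (p ^ (n - b)), ((σ ^ p ^ b) ^ j) x = 1) :
    ∃ y : Kˣ, (σ ^ p ^ b) (y : K) = x * y := by
  refine exists_map_eq_mul_of_prod_eq_one ?_ (pow_pos (Nat.pos_of_ne_zero hp) _) hx
  rw [orderOf_pow_of_dvd (pow_ne_zero _ hp) (hord ▸ pow_dvd_pow p hb.le), hord,
    Nat.pow_div hb.le (Nat.pos_of_ne_zero hp)]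

variable [FiniteDimensional F K] [IsGalois F K]

theorem algebraMap_norm_cyclicLayer (hp : p ≠ 0) (hn : 1 ≤ n) (hord : orderOf σ = p ^ n)
    (hσ : ∀ τ : Gal(K/F), τ ∈ Subgroup.zpowers σ) (ε : cyclicLayer p σ (n - 1)) :
    algebraMap F K (Algebra.norm F ε) = ∏ j ∈ range (p ^ (n - 1)), (σ ^ j) (ε : K) := by
  set H := Subgroup.zpowers (σ ^ p ^ (n - 1)) with hH
  have hcomm : ∀ a b : Gal(K/F), a * b = b * a := by
    intro a b
    obtain ⟨i, rfl⟩ := hσ a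
    obtain ⟨j, rfl⟩ := hσ b
    exact ((Commute.refl σ).zpow_zpow i j)
  have : H.Normal := ⟨fun a ha b => by rwa [hcomm b a, mul_inv_cancel_right]⟩
  have hgal : IsGalois F (cyclicLayer p σ (n - 1)) := IsGalois.of_fixedField_normal_subgroup H
  set g := AlgEquiv.restrictNormalHom (cyclicLayer p σ (n - 1)) σ with hgdef
  have hg : ∀ τ, τ ∈ Subgroup.zpowers g := by
    intro τ
    obtain ⟨τ, rfl⟩ := AlgEquiv.restrictNormalHom_surjective (F := F)
      (K₁ := cyclicLayer p σ (n - 1)) K τ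
    obtain ⟨k, rfl⟩ := hσ τ
    exact ⟨k, (map_zpow _ σ k).symm⟩
  have hr : orderOf g = p ^ (n - 1) := by
    rw [orderOf_eq_card_of_forall_mem_zpowers hg, IsGalois.card_aut_eq_finrank]
    have hfree : Module.Free F (cyclicLayer p σ (n - 1)) := Module.Free.of_divisionRing F _
    have hfree' : Module.Free (cyclicLayer p σ (n - 1)) K := Module.Free.of_divisionRing _ K
    have h1 := Module.finrank_mul_finrank F (cyclicLayer p σ (n - 1)) K
    have h2 : Module.finrank (cyclicLayer p σ (n - 1)) K = p := by
      have : Module.finrank (cyclicLayer p σ (n - 1)) K = Nat.card H :=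
        IntermediateField.finrank_fixedField_eq_card H
      rw [this, Nat.card_zpowers, orderOf_pow, hord, Nat.gcd_eq_right (pow_dvd_pow p (by omega)),
        Nat.pow_div (by omega) (Nat.pos_of_ne_zero hp), Nat.sub_sub_self hn, pow_one]
    rw [h2, ← IsGalois.card_aut_eq_finrank F K, ← orderOf_eq_card_of_forall_mem_zpowers hσ, hord] at h1
    apply Nat.eq_of_mul_eq_mul_right (Nat.pos_of_ne_zero hp)
    rw [h1, ← pow_succ, Nat.sub_add_cancel hn]
  have h1 := congrArg (algebraMap (cyclicLayer p σ (n - 1)) K)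
    (algebraMap_norm_eq_prod_range hg hr ε)
  rw [← IsScalarTower.algebraMap_apply, map_prod] at h1
  rw [h1]
  refine prod_congr rfl fun j _ => ?_
  rw [hgdef, ← map_pow]
  exact AlgEquiv.restrictNormal_commutes (σ ^ j) (cyclicLayer p σ (n - 1)) ε

end UnitGroup

/-! ### Translation between fields and modules. -/

section Translation

variable {F K : Type*} [Field F] [Field K] [Algebra F K] {p n m : ℕ} {σ : Gal(K/F)}

open GalUnits in
theorem GalUnits.cyclicData [hp : Fact p.Prime] (hord : orderOf σ = p ^ n) {ξ : F}
    (hξ : IsPrimitiveRoot ξ p) {ξ' : GalUnits σ} (hξ' : val ξ' = algebraMap F K ξ) :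
    CyclicData p n ξ' where
  period x := GalUnits.val_injective (by
    rw [val_X_pow_smul, ← hord, pow_orderOf_eq_one, AlgEquiv.one_apply])
  hilbert90 b hb x hx := by
    have h1 := congrArg val hx
    rw [sum_smul, val_sum, val_zero] at h1
    obtain ⟨y, hy⟩ := hilbert90_cyclicLayer hp.out.ne_zero hord hb (x := val x) (by
      rw [← h1]
      exact prod_congr rfl fun j _ => by rw [← pow_mul, ← pow_mul, val_X_pow_smul])
    refine ⟨of σ y, ?_⟩
    have h2 : x + of σ y = (X : ℤ[X]) ^ p ^ b • of σ y := GalUnits.val_injective (by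
      rw [val_add, val_X_pow_smul, val_of, hy])
    linear_combination (norm := module) h2
  torsion x hx := by
    have h1 := congrArg val hx
    rw [val_natCast_smul, val_zero] at h1
    have : NeZero p := ⟨hp.out.ne_zero⟩
    obtain ⟨j, -, hj⟩ := (hξ.map_of_injective (algebraMap F K).injective).eq_pow_of_pow_eq_one h1
    exact ⟨j, GalUnits.val_injective (by rw [val_intCast_smul, hξ', zpow_natCast, hj])⟩
  prime_smul := GalUnits.val_injective (by
    rw [val_natCast_smul, hξ', ← map_pow, hξ.pow_eq_one, map_one, val_zero])
  fixed := GalUnits.val_injective (by rw [val_X_smul, hξ', AlgEquiv.commutes])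
  ne_zero h := by
    have h1 := congrArg val h
    rw [hξ', val_zero, map_eq_one_iff _ (algebraMap F K).injective] at h1
    exact hξ.ne_one hp.out.one_lt h1

/-- The levels of a norm pair, indexed by all natural numbers. -/
def levels {n m : ℕ} (a : Fin m → WithBot (Fin (n + 1))) (i : ℕ) : WithBot ℕ :=
  if h : i < m then (a ⟨i, h⟩).map Fin.val else n

theorem levels_of_lt (a : Fin m → WithBot (Fin (n + 1))) (i : Fin m) :
    levels a i = (a i).map Fin.val := dif_pos i.2

theorem admissible_levels (hm : 1 ≤ m) {a : Fin m → WithBot (Fin (n + 1))}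
    (ha : ∀ i : Fin m, (i : ℕ) = 0 → a i < (Fin.last n : WithBot (Fin (n + 1)))) :
    Admissible n m (levels a) where
  le i _ := by
    rw [levels]
    split_ifs with h
    · cases a ⟨i, h⟩ with
      | bot => exact bot_le
      | coe j => exact WithBot.coe_le_coe.2 (Nat.lt_succ_iff.1 j.2)
    · exact le_rfl
  zero_lt := by
    have h := ha ⟨0, hm⟩ rfl
    rw [levels, dif_pos (Nat.lt_of_lt_of_le one_pos hm)]
    cases hj : a ⟨0, hm⟩ with
    | bot => exact WithBot.bot_lt_coe n
    | coe j =>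
      rw [hj] at h
      have h' : j < Fin.last n := WithBot.coe_lt_coe.1 h
      exact WithBot.coe_lt_coe.2 (Fin.lt_def.1 h')
  top := dif_neg (lt_irrefl m)

open GalUnits in
theorem inLayer_iff {l : WithBot (Fin (n + 1))} {x : GalUnits σ} :
    InLayer p (l.map Fin.val) x ↔ toUnit x ∈ layerUnits p σ l := by
  cases l with
  | bot => exact Iff.rfl
  | coe j =>
    change (X : ℤ[X]) ^ p ^ (j : ℕ) • x = x ↔ val x ∈ cyclicLayer p σ j
    rw [mem_cyclicLayer, ← val_X_pow_smul]
    exact GalUnits.val_injective.eq_iff.symm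

variable [FiniteDimensional F K] [IsGalois F K]

open GalUnits in
-- Norms are products over powers of `σ`, hence actions of geometric polynomials. The element `ε`
-- exists automatically, as `a_0 < n` puts `δ 0` in `K_{n-1}`.
theorem rep_iff [hp : Fact p.Prime] (hn : 1 ≤ n) (hm : 1 ≤ m) (hord : orderOf σ = p ^ n)
    (hσ : ∀ τ : Gal(K/F), τ ∈ Subgroup.zpowers σ) {ξ : F}
    (hξ : IsPrimitiveRoot ξ p) {ξ' : GalUnits σ} (hξ' : val ξ' = algebraMap F K ξ)
    {a : Fin m → WithBot (Fin (n + 1))}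
    (ha : ∀ i : Fin m, (i : ℕ) = 0 → a i < (Fin.last n : WithBot (Fin (n + 1))))
    {d e : ℤ} (hd : d = 1 + p * e) {α : GalUnits σ} {δ : ℕ → GalUnits σ} :
    Rep p n m ξ' (levels a) d e α δ ↔
      Represents p n m σ ξ a d (toUnit α) fun i => toUnit (δ i) := by
  have hp0 := hp.out.ne_zero
  have H := cyclicData hord hξ hξ'
  have hL := admissible_levels hm ha
  have hde : (d - 1) / (p : ℤ) = e := by
    rw [hd, add_sub_cancel_left, Int.mul_ediv_cancel_left _ (Nat.cast_ne_zero.2 hp0)]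
  have hlayer : (∀ i ≤ m, InLayer p (levels a i) (δ i)) ↔
      ∀ i : Fin m, toUnit (δ i) ∈ layerUnits p σ (a i) := by
    constructor
    · intro h i
      have := h i i.2.le
      rwa [levels_of_lt, inLayer_iff] at this
    · intro h i hi
      rcases hi.lt_or_eq with hi | rfl
      · have := h ⟨i, hi⟩
        rwa [← inLayer_iff, ← levels_of_lt] at this
      · rw [hL.top]; exact H.period _
  have hsub : (X - (d : ℤ[X])) • α = ∑ i ∈ range (m + 1), (p : ℤ[X]) ^ i • δ i ↔
      σ (val α) = val α ^ d * ∏ i : Fin (m + 1), val (δ i) ^ p ^ (i : ℕ) := by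
    rw [sub_smul, sub_eq_iff_eq_add', ← GalUnits.val_injective.eq_iff, val_X_smul, val_add,
      val_intCast_smul, val_sum, Finset.prod_range]
    simp_rw [val_natCast_pow_smul]
  have hnormN : ∀ x : GalUnits σ, val (geomPoly (p ^ n) • x) =
      algebraMap F K (Algebra.norm F (val x)) := fun x => by
    rw [val_geomPoly_smul, algebraMap_norm_eq_prod_range hσ hord]
  have hnorm : ∀ ε : cyclicLayer p σ (n - 1), (ε : K) = val (δ 0) →
      (ξ' = ((e : ℤ[X]) * geomPoly (p ^ n)) • α + ∑ i ∈ range (m + 1), normCoeff p n i • δ i ↔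
      ξ = Algebra.norm F (val α) ^ e * Algebra.norm F ε *
        ∏ i : Fin m, Algebra.norm F (val (δ (i + 1 : ℕ))) ^ p ^ (i : ℕ)) := by
    intro ε hε
    rw [← (algebraMap F K).injective.eq_iff, ← hξ', ← GalUnits.val_injective.eq_iff, val_add, mul_smul,
      val_intCast_smul, hnormN, sum_range_succ', val_add, val_sum, map_mul, map_mul, map_zpow₀,
      algebraMap_norm_cyclicLayer hp0 hn hord hσ, map_prod, Finset.prod_range, hε]
    have h1 : val (normCoeff p n 0 • δ 0) = ∏ j ∈ range (p ^ (n - 1)), (σ ^ j) (val (δ 0)) := by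
      rw [normCoeff, if_pos rfl, val_geomPoly_smul]
    have h2 : ∀ i : ℕ, val (normCoeff p n (i + 1) • δ (i + 1)) =
        algebraMap F K (Algebra.norm F (val (δ (i + 1))) ^ p ^ i) := by
      intro i
      rw [normCoeff, if_neg (by omega), Nat.add_sub_cancel, mul_smul, val_natCast_pow_smul, hnormN,
        map_pow]
    simp_rw [h1, h2]
    rw [mul_assoc, mul_comm (∏ i : Fin m, _)]
  constructor
  · intro R
    have h0 : val (δ 0) ∈ cyclicLayer p σ (n - 1) := by
      rw [mem_cyclicLayer, ← val_X_pow_smul, GalUnits.val_injective.eq_iff]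
      have h1 := R.layer 0 (Nat.zero_le m)
      cases hl : levels a 0 with
      | bot =>
        rw [hl] at h1
        rw [show δ 0 = 0 from h1, smul_zero]
      | coe b =>
        rw [hl] at h1
        have := (hL.le_of_eq (Nat.zero_le m) hl).2 rfl
        exact X_pow_smul_of_le (by omega) h1
    refine ⟨hlayer.1 R.layer, hsub.1 R.sub_smul, ⟨val (δ 0), h0⟩, rfl, ?_⟩
    rw [hde]
    exact (hnorm ⟨val (δ 0), h0⟩ rfl).1 R.norm_eq
  · rintro ⟨h1, h2, ε, hε, h3⟩
    rw [hde] at h3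
    exact ⟨hd, hlayer.2 h1, hsub.2 h2, (hnorm ε hε).2 h3⟩

end Translation

/-! ### Root levels and minimal norm pairs. -/

section Minimality

variable {F K : Type*} [Field F] [Field K] [Algebra F K] {p n m : ℕ} {σ : Gal(K/F)}

section RootLevel

open GalUnits

theorem one_le_rootLevel {ξ : F} (hξ : IsPrimitiveRoot ξ p) : 1 ≤ rootLevel p F := by
  have := le_iSup₂ (f := fun (k : ℕ) (_ : ∃ ζ : F, IsPrimitiveRoot ζ (p ^ k)) => (k : ℕ∞)) 1
    ⟨ξ, by rwa [pow_one]⟩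
  exact_mod_cast this

variable [hp : Fact p.Prime] {ξ : F} {ξ' : GalUnits σ}

theorem isPrimitiveRoot_val (hξ : IsPrimitiveRoot ξ p) (hξ' : val ξ' = algebraMap F K ξ) {k : ℕ}
    {ζ : GalUnits σ} (hζ : (p : ℤ[X]) ^ k • ζ = ξ') : IsPrimitiveRoot (val ζ) (p ^ (k + 1)) := by
  have h1 := congrArg GalUnits.val hζ
  rw [val_natCast_pow_smul, hξ'] at h1
  have h2 := hξ.map_of_injective (algebraMap F K).injective
  have h3 : orderOf (val ζ) = p ^ (k + 1) := by
    refine orderOf_eq_prime_pow ?_ ?_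
    · rw [h1]; exact h2.ne_one hp.out.one_lt
    · rw [pow_succ, pow_mul, h1, h2.pow_eq_one]
  exact h3 ▸ IsPrimitiveRoot.orderOf _

theorem exists_pow_smul_eq {L : Type*} [Field L] (g : L →+* K) (hξ : IsPrimitiveRoot ξ p)
    (hξ' : val ξ' = algebraMap F K ξ) {k : ℕ} (hk : ((k + 1 : ℕ) : ℕ∞) ≤ rootLevel p L) :
    ∃ ζ : GalUnits σ, (p : ℤ[X]) ^ k • ζ = ξ' ∧ ∃ z, val ζ = g z := by
  obtain ⟨η, hη⟩ := exists_isPrimitiveRoot_of_le_rootLevel hk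
  have : NeZero p := ⟨hp.out.ne_zero⟩
  have h1 : IsPrimitiveRoot (g η ^ p ^ k) p :=
    (hη.map_of_injective g.injective).pow (pow_pos hp.out.pos _) (pow_succ p k)
  have h2 := hξ.map_of_injective (algebraMap F K).injective
  obtain ⟨j, -, hj⟩ := h1.eq_pow_of_pow_eq_one h2.pow_eq_one
  have h0 : g η ^ j ≠ 0 := by
    refine pow_ne_zero _ ((map_ne_zero g).2 (hη.ne_zero ?_))
    exact pow_ne_zero _ hp.out.ne_zero
  refine ⟨of σ (Units.mk0 _ h0), GalUnits.val_injective ?_, η ^ j, by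
    rw [val_of, Units.val_mk0, map_pow]⟩
  rw [val_natCast_pow_smul, val_of, Units.val_mk0, hξ', ← hj, ← pow_mul, ← pow_mul, mul_comm]

theorem le_rootLevel_of_pow_smul_eq (hξ : IsPrimitiveRoot ξ p)
    (hξ' : val ξ' = algebraMap F K ξ) {k : ℕ} {ζ : GalUnits σ} (hζ : (p : ℤ[X]) ^ k • ζ = ξ') :
    ((k + 1 : ℕ) : ℕ∞) ≤ rootLevel p K :=
  le_iSup₂ (f := fun (k : ℕ) (_ : ∃ ζ : K, IsPrimitiveRoot ζ (p ^ k)) => (k : ℕ∞)) (k + 1)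
    ⟨_, isPrimitiveRoot_val hξ hξ' hζ⟩

theorem le_rootLevel_of_fixed [FiniteDimensional F K] [IsGalois F K]
    (hσ : ∀ τ : Gal(K/F), τ ∈ Subgroup.zpowers σ) (hξ : IsPrimitiveRoot ξ p)
    (hξ' : val ξ' = algebraMap F K ξ) {k : ℕ} {ζ : GalUnits σ} (hζ : (p : ℤ[X]) ^ k • ζ = ξ')
    (hfix : (X : ℤ[X]) • ζ = ζ) : ((k + 1 : ℕ) : ℕ∞) ≤ rootLevel p F := by
  have h1 : val ζ ∈ Set.range (algebraMap F K) := by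
    rw [IsGalois.mem_range_algebraMap_iff_fixed]
    intro τ
    have : Subgroup.zpowers σ ≤ MulAction.stabilizer Gal(K/F) (val ζ) := by
      rw [Subgroup.zpowers_le]
      exact (val_X_smul ζ).symm.trans (congrArg GalUnits.val hfix)
    exact this (hσ τ)
  obtain ⟨z, hz⟩ := h1
  have h2 := isPrimitiveRoot_val hξ hξ' hζ
  rw [← hz] at h2
  exact le_iSup₂ (f := fun (k : ℕ) (_ : ∃ ζ : F, IsPrimitiveRoot ζ (p ^ k)) => (k : ℕ∞)) (k + 1)
    ⟨z, h2.of_map_of_injective (algebraMap F K).injective⟩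

/-- Roots of unity of `p`-power order are fixed up to the level of the base field. -/
theorem X_smul_eq_of_le_rootLevel (hord : orderOf σ = p ^ n) (hξ : IsPrimitiveRoot ξ p)
    (hξ' : val ξ' = algebraMap F K ξ) {k : ℕ} (hk : ((k + 1 : ℕ) : ℕ∞) ≤ rootLevel p F)
    {x : GalUnits σ} (hx : (p : ℤ[X]) ^ (k + 1) • x = 0) : (X : ℤ[X]) • x = x := by
  obtain ⟨ζ, hζ, z, hz⟩ := exists_pow_smul_eq (algebraMap F K) hξ hξ' hk
  obtain ⟨j, rfl⟩ := (cyclicData hord hξ hξ').exists_smul_of_pow_smul_eq_zero hζ hx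
  have : (X : ℤ[X]) • ζ = ζ := GalUnits.val_injective (by rw [val_X_smul, hz, AlgEquiv.commutes])
  rw [smul_comm, this]

end RootLevel

open GalUnits in
theorem isNormPair_iff [FiniteDimensional F K] [IsGalois F K] [hp : Fact p.Prime] (hn : 1 ≤ n)
    (hm : 1 ≤ m) (hord : orderOf σ = p ^ n)
    (hσ : ∀ τ : Gal(K/F), τ ∈ Subgroup.zpowers σ) {ξ : F}
    (hξ : IsPrimitiveRoot ξ p) {ξ' : GalUnits σ} (hξ' : val ξ' = algebraMap F K ξ)
    {a : Fin m → WithBot (Fin (n + 1))}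
    (ha : ∀ i : Fin m, (i : ℕ) = 0 → a i < (Fin.last n : WithBot (Fin (n + 1)))) {d : ℤ} :
    IsNormPair p n m σ ξ a d ↔ ∃ e α δ, Rep p n m ξ' (levels a) d e α δ := by
  constructor
  · rintro ⟨-, hd, α, δ, h⟩
    obtain ⟨e, he⟩ := (Int.modEq_iff_dvd.1 hd.symm)
    refine ⟨e, of σ α, fun i => if h : i < m + 1 then of σ (δ ⟨i, h⟩) else 0, ?_⟩
    rw [rep_iff hn hm hord hσ hξ hξ' ha (by linarith)]
    convert h using 1
    · rfl
    · funext i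
      rw [dif_pos i.2, toUnit_of]
  · rintro ⟨e, α, δ, R⟩
    exact ⟨ha, (Int.modEq_iff_dvd.2 R.dvd_sub_one).symm, _, _,
      (rep_iff hn hm hord hσ hξ hξ' ha R.eq_one_add).1 R⟩

open GalUnits in
/-- The minimality of a norm pair, in terms of levels. -/
theorem _root_.IsMinimalNormPair.not_rep_lower [FiniteDimensional F K] [IsGalois F K] [hp : Fact p.Prime]
    (hn : 1 ≤ n) (hm : 1 ≤ m) (hord : orderOf σ = p ^ n)
    (hσ : ∀ τ : Gal(K/F), τ ∈ Subgroup.zpowers σ) {ξ : F}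
    (hξ : IsPrimitiveRoot ξ p) {ξ' : GalUnits σ} (hξ' : val ξ' = algebraMap F K ξ)
    {a : Fin m → WithBot (Fin (n + 1))} {d : ℤ} (hmin : IsMinimalNormPair p n m σ ξ a d)
    {i : ℕ} (hi : i < m) {b : ℕ} (hb : levels a i = b) {l : WithBot ℕ} (hl : l < (b : WithBot ℕ))
    {d' e' : ℤ} {α' : GalUnits σ} {δ' : ℕ → GalUnits σ} :
    ¬ Rep p n m ξ' (fun j => if j < i then levels a j else if j = i then l else n)
      d' e' α' δ' := by
  intro R
  have ha := hmin.1.1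
  have hbn := ((admissible_levels hm ha).le_of_eq hi.le hb).1
  obtain ⟨l', rfl⟩ : ∃ l' : WithBot (Fin (n + 1)), l'.map Fin.val = l := by
    cases l with
    | bot => exact ⟨⊥, rfl⟩
    | coe c => exact ⟨((⟨c, by
        have : c < b := WithBot.coe_lt_coe.1 hl
        omega⟩ : Fin (n + 1)) :
        WithBot (Fin (n + 1))), rfl⟩
  have hlt : l' < a ⟨i, hi⟩ := by
    rw [levels, dif_pos hi] at hb
    rw [← hb] at hl
    cases l' with
    | bot =>
      cases h : a ⟨i, hi⟩ with
      | bot => rw [h] at hl; exact absurd hl (lt_irrefl _)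
      | coe c => exact WithBot.bot_lt_coe c
    | coe j =>
      cases h : a ⟨i, hi⟩ with
      | bot => rw [h] at hl; exact absurd hl not_lt_bot
      | coe c =>
        rw [h] at hl
        have hl' : (j : ℕ) < (c : ℕ) := WithBot.coe_lt_coe.1 hl
        exact WithBot.coe_lt_coe.2 (Fin.lt_def.2 hl')
  set a' : Fin m → WithBot (Fin (n + 1)) := fun j =>
    if (j : ℕ) < i then a j else if (j : ℕ) = i then l' else (Fin.last n : Fin (n + 1)) with ha'
  have hlex : toLex a' < toLex a := by
    refine ⟨⟨i, hi⟩, fun j hj => ?_, ?_⟩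
    · have : (j : ℕ) < i := hj
      simp [ha', this]
    · simpa [ha'] using hlt
  have ha0 : ∀ j : Fin m, (j : ℕ) = 0 → a' j < (Fin.last n : WithBot (Fin (n + 1))) := by
    intro j hj
    rcases Nat.eq_zero_or_pos i with rfl | hi0
    · have : a' j = l' := by simp [ha', hj]
      rw [this]
      exact hlt.trans (ha _ rfl)
    · have : a' j = a j := by simp [ha', hj, hi0]
      rw [this]
      exact ha j hj
  have hlev : levels a' = fun j => if j < i then levels a j else
      if j = i then l'.map Fin.val else n := by
    funext j
    by_cases hj : j < m
    · rw [levels, dif_pos hj]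
      simp only [ha', apply_ite (WithBot.map Fin.val)]
      split_ifs with h1 h2
      · rw [levels, dif_pos hj]
      · rfl
      · rfl
    · rw [levels, dif_neg hj, if_neg (by omega), if_neg (by omega)]
  rw [← hlev] at R
  have h1 := (isNormPair_iff hn hm hord hσ hξ hξ' ha0).2 ⟨_, _, _, R⟩
  rcases hmin.2 a' d' h1 (Or.inl hlex) with h2 | ⟨h2, -⟩
  · exact lt_asymm hlex h2
  · rw [h2] at hlex
    exact lt_irrefl _ hlex

end Minimality

/-! ### The three conclusions for minimal norm pairs. -/

section CyclotomicCharacter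

variable {F K : Type*} [Field F] [Field K] [Algebra F K] [FiniteDimensional F K] [IsGalois F K]
  {p n m : ℕ} {σ : Gal(K/F)} [hp : Fact p.Prime] {ξ : F} {ξ' : GalUnits σ}
  {a : Fin m → WithBot (Fin (n + 1))} {d : ℤ}

open GalUnits

/-- A minimal norm pair satisfies the divisibility bounds up to the level of `K`, and `σ` acts on
the roots of unity up to that level through `d`. -/
theorem _root_.IsMinimalNormPair.divBound_and_exists_root (hn : 1 ≤ n) (hm : 1 ≤ m)
    (hord : orderOf σ = p ^ n) (hσ : ∀ τ : Gal(K/F), τ ∈ Subgroup.zpowers σ)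
    (hξ : IsPrimitiveRoot ξ p) (hξ' : val ξ' = algebraMap F K ξ)
    (hp2 : ¬ (p = 2 ∧ rootLevel p F = 1 ∧ 1 < rootLevel p K))
    (hmin : IsMinimalNormPair p n m σ ξ a d) {k : ℕ} (hkm : k < m)
    (hk : ((k + 1 : ℕ) : ℕ∞) ≤ rootLevel p K) :
    DivBound p n m (levels a) d (k + 1) ∧
      ∃ ζ : GalUnits σ, (p : ℤ[X]) ^ k • ζ = ξ' ∧ (X - (d : ℤ[X])) • ζ = 0 := by
  have H := cyclicData hord hξ hξ'
  have hL := admissible_levels hm hmin.1.1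
  obtain ⟨e, α, δ, R⟩ := (isNormPair_iff hn hm hord hσ hξ hξ' hmin.1.1).1 hmin.1
  obtain ⟨ζ, hζ, -⟩ := exists_pow_smul_eq (σ := σ) (RingHom.id K) hξ hξ' hk
  have hB : DivBound p n m (levels a) d (k + 1) := by
    refine R.divBound_of_minimal hn H hL (fun i hi b hb l hl d' e' α' δ' => ?_) hkm hζ ?_
    · exact hmin.not_rep_lower hn hm hord hσ hξ hξ' hi hb hl
    -- Excluding `ω = 1 < ν` for `p = 2` gives `ω ≥ 2` here, so `σ` fixes the fourth roots of unity.
    · rintro hk1 rfl x hx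
      have h1 : 1 < rootLevel 2 K := lt_of_lt_of_le (by exact_mod_cast (by omega : 1 < k + 1)) hk
      have h2 : ((1 + 1 : ℕ) : ℕ∞) ≤ rootLevel 2 F := by
        rw [Nat.cast_add, Nat.cast_one]
        exact Order.add_one_le_of_lt
          ((one_le_rootLevel hξ).lt_of_ne fun h => hp2 ⟨rfl, h.symm, h1⟩)
      refine X_smul_eq_of_le_rootLevel hord hξ hξ' h2 ?_
      rw [← hx]
      congr 1
      norm_num
  refine ⟨hB, ?_⟩
  obtain ⟨c, f, z, -, -, h1, h2⟩ := R.exists_root hL hB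
  exact ⟨-((c : ℤ[X]) • α - f - (p : ℤ[X]) • z), by rw [smul_neg, h2, neg_neg],
    by rw [smul_neg, h1, neg_zero]⟩

/-- `σ` raises a primitive `p ^ k`-th root of unity to the power `d`, so that root lies in `F`
exactly when `d ≡ 1` modulo `p ^ k`. -/
theorem _root_.IsMinimalNormPair.pow_dvd_sub_one_iff (hn : 1 ≤ n) (hm : 1 ≤ m)
    (hord : orderOf σ = p ^ n) (hσ : ∀ τ : Gal(K/F), τ ∈ Subgroup.zpowers σ)
    (hξ : IsPrimitiveRoot ξ p) (hξ' : val ξ' = algebraMap F K ξ)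
    (hp2 : ¬ (p = 2 ∧ rootLevel p F = 1 ∧ 1 < rootLevel p K))
    (hmin : IsMinimalNormPair p n m σ ξ a d) {k : ℕ} (hkm : k ≤ m)
    (hk : (k : ℕ∞) ≤ rootLevel p K) :
    (p : ℤ) ^ k ∣ d - 1 ↔ (k : ℕ∞) ≤ rootLevel p F := by
  obtain _ | k := k
  · simp
  have H := cyclicData hord hξ hξ'
  obtain ⟨-, ζ, hζ, hζd⟩ := hmin.divBound_and_exists_root hn hm hord hσ hξ hξ' hp2 hkm hk
  have hpζ : (p : ℤ[X]) ^ (k + 1) • ζ = 0 := by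
    rw [pow_succ', mul_smul, hζ, H.prime_smul]
  constructor
  · rintro ⟨c, hc⟩
    refine le_rootLevel_of_fixed hσ hξ hξ' hζ ?_
    have hc' : (d : ℤ[X]) = 1 + p ^ (k + 1) * c := by
      rw [← sub_add_cancel d 1, hc]
      push_cast
      ring
    rw [hc'] at hζd
    linear_combination (norm := module) hζd + (c : ℤ[X]) • hpζ
  · intro h
    have h1 := X_smul_eq_of_le_rootLevel hord hξ hξ' h hpζ
    refine H.pow_dvd_of_smul_eq_zero hζ ?_
    push_cast
    linear_combination (norm := module) h1 - hζd

/-- A minimal norm pair remains a norm pair if `d` is changed modulo `p ^ ν`. -/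
theorem _root_.IsMinimalNormPair.isNormPair_of_congr (hn : 1 ≤ n) (hm : 1 ≤ m)
    (hord : orderOf σ = p ^ n) (hσ : ∀ τ : Gal(K/F), τ ∈ Subgroup.zpowers σ)
    (hξ : IsPrimitiveRoot ξ p) (hξ' : val ξ' = algebraMap F K ξ)
    (hp2 : ¬ (p = 2 ∧ rootLevel p F = 1 ∧ 1 < rootLevel p K))
    (hmin : IsMinimalNormPair p n m σ ξ a d) {d' : ℤ} (hdd : CongrModPow p (rootLevel p K) d' d)
    (hreg : rootLevel p K < m → Regular p d') : IsNormPair p n m σ ξ a d' := by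
  have H := cyclicData hord hξ hξ'
  have hL := admissible_levels hm hmin.1.1
  obtain ⟨e, α, δ, R⟩ := (isNormPair_iff hn hm hord hσ hξ hξ' hmin.1.1).1 hmin.1
  have hdvd : ∀ k : ℕ, (k : ℕ∞) ≤ rootLevel p K → (p : ℤ) ^ k ∣ d' - d := fun k hk =>
    Int.modEq_iff_dvd.1 (hdd k hk).symm
  rw [isNormPair_iff hn hm hord hσ hξ hξ' hmin.1.1]
  rcases le_or_gt (m : ℕ∞) (rootLevel p K) with hmν | hmν
  · have h1 := hdvd m hmν
    obtain ⟨e', he'⟩ : (p : ℤ) ∣ d' - 1 := by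
      rw [← sub_add_sub_cancel d' d 1]
      exact dvd_add ((dvd_pow_self _ (by omega)).trans h1) R.dvd_sub_one
    -- For `m ≤ ν`, the unrestricted `δ_m` absorbs any change of `d` modulo `p ^ m`.
    exact ⟨e', R.exists_of_modEq H hm hL le_rfl hL.top (by omega) (by linarith) h1
      (Or.inl le_rfl)⟩
  · obtain ⟨N, hN⟩ := ENat.ne_top_iff_exists.1 (ne_top_of_lt hmν)
    have hN1 : 1 ≤ rootLevel p K := by
      have := le_rootLevel_of_pow_smul_eq (k := 0) (ζ := ξ') hξ hξ' (by rw [pow_zero, one_smul])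
      simpa using this
    rw [← hN] at hmν hN1
    have hNm : N < m := by exact_mod_cast hmν
    obtain ⟨k, rfl⟩ : ∃ k, N = k + 1 := Nat.exists_eq_add_of_le' (by exact_mod_cast hN1)
    obtain ⟨hB, ζ, hζ, hζd⟩ :=
      hmin.divBound_and_exists_root hn hm hord hσ hξ hξ' hp2 (by omega) hN.le
    refine R.exists_of_not_divisible H hn hm hL hB hζ hζd (fun x hx => ?_)
      (hreg (hN ▸ hmν)) (hdvd _ hN.le)
    have h1 := le_rootLevel_of_pow_smul_eq hξ hξ' hx
    rw [← hN] at h1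
    have h2 : k + 1 + 1 ≤ k + 1 := by exact_mod_cast h1
    omega

/-- Because `ω < ν`, both `d - 1` and `d' - 1` have truncated valuation `min(ω, m)`, so the two
pairs are equivalent in the ordering. -/
theorem _root_.IsMinimalNormPair.of_congr (hn : 1 ≤ n) (hm : 1 ≤ m)
    (hord : orderOf σ = p ^ n) (hσ : ∀ τ : Gal(K/F), τ ∈ Subgroup.zpowers σ)
    (hξ : IsPrimitiveRoot ξ p) (hξ' : val ξ' = algebraMap F K ξ)
    (hp2 : ¬ (p = 2 ∧ rootLevel p F = 1 ∧ 1 < rootLevel p K))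
    (hmin : IsMinimalNormPair p n m σ ξ a d) (hlt : rootLevel p F < rootLevel p K) {d' : ℤ}
    (hdd : CongrModPow p (rootLevel p K) d' d) : IsMinimalNormPair p n m σ ξ a d' := by
  have hdvd : ∀ k : ℕ, (k : ℕ∞) ≤ rootLevel p K → ((p : ℤ) ^ k ∣ d' - 1 ↔ (p : ℤ) ^ k ∣ d - 1) := by
    intro k hk
    rw [← sub_add_sub_cancel d' d 1]
    exact dvd_add_right (Int.modEq_iff_dvd.1 (hdd k hk).symm)
  have hiff : ∀ k ≤ m, (k : ℕ∞) ≤ rootLevel p K → ((p : ℤ) ^ k ∣ d - 1 ↔ (k : ℕ∞) ≤ rootLevel p F) :=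
    fun k => hmin.pow_dvd_sub_one_iff hn hm hord hσ hξ hξ' hp2
  have hpair : IsNormPair p n m σ ξ a d' := by
    refine hmin.isNormPair_of_congr hn hm hord hσ hξ hξ' hp2 hdd fun hνm => ⟨?_, ?_⟩
    · have h1 : ((1 : ℕ) : ℕ∞) ≤ rootLevel p F := by exact_mod_cast one_le_rootLevel hξ
      have := (hdvd 1 (h1.trans hlt.le)).2 ((hiff 1 hm (h1.trans hlt.le)).2 h1)
      rwa [pow_one] at this
    · intro h2
      have h1 : ((2 : ℕ) : ℕ∞) ≤ rootLevel p F := by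
        have := Order.add_one_le_of_lt ((one_le_rootLevel hξ).lt_of_ne fun h =>
          hp2 ⟨h2, h.symm, by rwa [← h] at hlt⟩)
        exact_mod_cast this
      have h3 := h1.trans hlt.le
      have h4 : 2 ≤ m := by exact_mod_cast h3.trans hνm.le
      have := (hdvd 2 h3).2 ((hiff 2 h4 h3).2 h1)
      rw [h2] at this
      norm_num at this
      exact this
  have hmult : min (emultiplicity (p : ℤ) (d' - 1)) (m : ℕ∞) =
      min (emultiplicity (p : ℤ) (d - 1)) (m : ℕ∞) := by
    refine min_emultiplicity_congr fun k hkm => ?_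
    rcases le_or_gt (k : ℕ∞) (rootLevel p K) with hk | hk
    · exact hdvd k hk
    · obtain ⟨N, hN⟩ := ENat.ne_top_iff_exists.1 (ne_top_of_lt hk)
      have hNk : N < k := by rw [← hN] at hk; exact_mod_cast hk
      have hnot : ¬ (p : ℤ) ^ N ∣ d - 1 := fun h =>
        ((hiff N (by omega) hN.le).1 h).not_gt (hN ▸ hlt)
      exact iff_of_false
        (fun h => hnot ((hdvd N hN.le).1 ((pow_dvd_pow _ hNk.le).trans h)))
        (fun h => hnot ((pow_dvd_pow _ hNk.le).trans h))
  refine ⟨hpair, fun a' d'' h hle => ?_⟩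
  unfold NormPairLE at hle ⊢
  rw [hmult] at hle ⊢
  exact hmin.2 a' d'' h hle

/-- For `ν < m`, `d ≡ 1` modulo `p ^ ν`, so `(a, 1)` is again a norm pair. It lies below `(a, d)`
since `v_p(0) = ∞`, and minimality forces the valuation of `d - 1` up to `m`. -/
theorem _root_.IsMinimalNormPair.pow_dvd_sub_one (hn : 1 ≤ n) (hm : 1 ≤ m)
    (hord : orderOf σ = p ^ n) (hσ : ∀ τ : Gal(K/F), τ ∈ Subgroup.zpowers σ)
    (hξ : IsPrimitiveRoot ξ p) (hξ' : val ξ' = algebraMap F K ξ)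
    (hp2 : ¬ (p = 2 ∧ rootLevel p F = 1 ∧ 1 < rootLevel p K))
    (hmin : IsMinimalNormPair p n m σ ξ a d) (heq : rootLevel p F = rootLevel p K) :
    (p : ℤ) ^ m ∣ d - 1 := by
  have hiff : ∀ k ≤ m, (k : ℕ∞) ≤ rootLevel p K → (p : ℤ) ^ k ∣ d - 1 := fun k hkm hk =>
    (hmin.pow_dvd_sub_one_iff hn hm hord hσ hξ hξ' hp2 hkm hk).2 (heq ▸ hk)
  rcases le_or_gt (m : ℕ∞) (rootLevel p K) with hmν | hmν
  · exact hiff m le_rfl hmν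
  have hpair : IsNormPair p n m σ ξ a 1 := by
    refine hmin.isNormPair_of_congr hn hm hord hσ hξ hξ' hp2 (fun k hk => ?_) fun _ => ?_
    · refine Int.modEq_iff_dvd.2 (hiff k ?_ hk)
      exact_mod_cast hk.trans hmν.le
    · exact ⟨by simp, fun _ => by simp⟩
  rcases hmin.2 a 1 hpair (Or.inr ⟨rfl, by simp⟩) with h | ⟨-, h⟩
  · exact absurd h (lt_irrefl _)
  · rw [sub_self, emultiplicity_zero, top_inf_eq, le_min_iff] at h
    exact pow_dvd_of_le_emultiplicity h.1

theorem _root_.IsMinimalNormPair.eq_cyclotomicCharacterMod (hn : 1 ≤ n) (hm : 1 ≤ m)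
    (hord : orderOf σ = p ^ n) (hσ : ∀ τ : Gal(K/F), τ ∈ Subgroup.zpowers σ)
    (hξ : IsPrimitiveRoot ξ p) (hξ' : val ξ' = algebraMap F K ξ)
    (hp2 : ¬ (p = 2 ∧ rootLevel p F = 1 ∧ 1 < rootLevel p K))
    (hmin : IsMinimalNormPair p n m σ ξ a d) {k : ℕ} (hkm : k ≤ m)
    (hk : (k : ℕ∞) ≤ rootLevel p K) : (d : ZMod (p ^ k)) = cyclotomicCharacterMod hk σ := by
  obtain _ | k := k
  · have : Subsingleton (ZMod (p ^ 0)) := by rw [pow_zero]; infer_instance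
    exact Subsingleton.elim (α := ZMod (p ^ 0)) _ _
  have H := cyclicData hord hξ hξ'
  obtain ⟨-, ζ, hζ, hζd⟩ := hmin.divBound_and_exists_root hn hm hord hσ hξ hξ' hp2 hkm hk
  have : NeZero (p ^ (k + 1)) := ⟨pow_ne_zero _ hp.out.ne_zero⟩
  have h1 := modularCyclotomicCharacter.spec K (natCard_rootsOfUnity_of_le_rootLevel hk)
    σ.toRingEquiv (t := toUnit ζ) (by
      rw [mem_rootsOfUnity']
      exact (isPrimitiveRoot_val hξ hξ' hζ).pow_eq_one)
  change σ (val ζ) = _ ^ (cyclotomicCharacterMod hk σ).val at h1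
  have h2 : (X : ℤ[X]) • ζ = ((cyclotomicCharacterMod hk σ).val : ℤ[X]) • ζ :=
    GalUnits.val_injective (by rw [val_X_smul, val_natCast_smul, h1, coe_toUnit])
  have h3 : (p : ℤ) ^ (k + 1) ∣ (cyclotomicCharacterMod hk σ).val - d := by
    refine H.pow_dvd_of_smul_eq_zero hζ ?_
    push_cast
    linear_combination (norm := module) hζd - h2
  have h4 := (ZMod.intCast_eq_intCast_iff_dvd_sub d (cyclotomicCharacterMod hk σ).val
    (p ^ (k + 1))).2 (by exact_mod_cast h3)
  rw [h4, Int.cast_natCast, ZMod.natCast_zmod_val]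

end CyclotomicCharacter

end CyclicNormPair

theorem theorem1 {F K : Type*} [Field F] [Field K] [Algebra F K] [FiniteDimensional F K]
    [IsGalois F K] (p n m : ℕ) [Fact p.Prime] (hn : 1 ≤ n) (hm : 1 ≤ m)
    (hG : Nonempty (Gal(K/F) ≃* Multiplicative (ZMod (p ^ n))))
    (σ : Gal(K/F)) (hσ : ∀ τ : Gal(K/F), τ ∈ Subgroup.zpowers σ)
    (ξ : F) (hξ : IsPrimitiveRoot ξ p)
    (hp2n1 : p = 2 → n = 1 → ∃ x : K, Algebra.norm F x = -1)
    (hp2 : ¬ (p = 2 ∧ rootLevel p F = 1 ∧ 1 < rootLevel p K))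
    (a : Fin m → WithBot (Fin (n + 1))) (d : ℤ) (hmin : IsMinimalNormPair p n m σ ξ a d) :
    (rootLevel p F < rootLevel p K →
      ∀ d' : ℤ, CongrModPow p (rootLevel p K) d' d → IsMinimalNormPair p n m σ ξ a d') ∧
    (rootLevel p F = rootLevel p K → d ≡ 1 [ZMOD (p : ℤ) ^ m]) ∧
    (∀ (k : ℕ) (_ : k ≤ m) (hk : (k : ℕ∞) ≤ rootLevel p K),
      ((d : ℤ) : ZMod (p ^ k)) = cyclotomicCharacterMod hk σ) := by
  have hord := CyclicNormPair.orderOf_eq_of_mulEquiv hG hσ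
  have hξ0 : algebraMap F K ξ ≠ 0 :=
    (map_ne_zero _).2 (hξ.ne_zero (Fact.out : p.Prime).ne_zero)
  have hξ' : CyclicNormPair.GalUnits.val (CyclicNormPair.GalUnits.of σ (Units.mk0 _ hξ0)) =
      algebraMap F K ξ := rfl
  refine ⟨fun hlt d' hdd => ?_, fun heq => ?_, fun k hkm hk => ?_⟩
  · exact hmin.of_congr hn hm hord hσ hξ hξ' hp2 hlt hdd
  · exact (Int.modEq_iff_dvd.2 (hmin.pow_dvd_sub_one hn hm hord hσ hξ hξ' hp2 heq)).symm
  · exact hmin.eq_cyclotomicCharacterMod hn hm hord hσ hξ hξ' hp2 hkm hk
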